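/- Let $(N^{2n+1},\varphi,\xi,\eta,g)$ be a Sasakian space form of constant $\varphi$-sectional curvature $c$, that is: a smooth Riemannian manifold $(N,g)$ with Levi-Civita connection $\nabla$, a smooth $(1,1)$-tensor field $\varphi$, a smooth vector field $\xi$ and a smooth $1$-form $\eta$ such that $\varphi^2=-I+\eta\otimes\xi$, $\eta(\xi)=1$, $g(\varphi X,\varphi Y)=g(X,Y)-\eta(X)\eta(Y)$, $g(X,\varphi Y)=d\eta(X,Y)$ (with $2\,d\eta(X,Y)=X\eta(Y)-Y\eta(X)-\eta([X,Y])$), $(\nabla_X\varphi)Y=g(X,Y)\xi-\eta(Y)X$, and such that the plane spanned by $X$ and $\varphi X$ has sectional curvature $c$ for every unit tangent vector $X\perp\xi$. A smooth unit-speed curve $\gamma:J\to N$ on an open interval, with $T=\gamma'$, is a Frenet curve of osculating order $r\ge 1$ if there are smooth orthonormal vector fields $E_1=T,E_2,\dots,E_r$ along $\gamma$ and positive smooth functions $\kappa_1,\dots,\kappa_{r-1}$ on $J$ with $\nabla_TE_i=-\kappa_{i-1}E_{i-1}+\kappa_iE_{i+1}$ for $1\le i\le r$ (terms with $E_0$ or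 $E_{r+1}$ being omitted). It is a circle if $r=2$ and $\kappa_1$ is constant, and a helix if $r=3$ and $\kappa_1,\kappa_2$ are constant. It is biharmonic if $\tau_2(\gamma)=\nabla_T^3T-R(T,\nabla_TT)T$ vanishes identically, where $R(X,Y)Z=\nabla_X\nabla_YZ-\nabla_Y\nabla_XZ-\nabla_{[X,Y]}Z$, and proper-biharmonic if moreover it is not harmonic, i.e. $\nabla_TT$ does not vanish identically. Assume that $c\neq 1$ and let $\gamma:J\to N$ be a Frenet curve of some osculating order $r$ which is not a Legendre curve (i.e. $\eta(T)$ is not identically $0$) and which satisfies $\nabla_TT\parallel\varphi T$ (linear dependence at every point of $J$). Then $\gamma$ is proper-biharmonic if and only if there is a constant $\beta_0\in(0,2\pi)\setminus\{\frac{\pi}{2},\pi,\frac{3\pi}{2}\}$ with $c-(c-1)\cos^2\beta_0>0$ such that either a) $\gamma$ is a circle with $\eta(T)=\cos\beta_0$ and $\kappa_1^2=c-(c-1)\cos^2\beta_0$, or b) $\gamma$ is a helix with $\eta(T)=\cos\beta_0$ and $\kappa_1^2+\kappa_2^2=c-(c-1)\cos^2\beta_0$. -/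

import Mathlib

open Bundle Set
open scoped Manifold ContDiff

noncomputable section

namespace SasakianCurves

section Connection

variable {m : ℕ} {N : Type*} [TopologicalSpace N] [ChartedSpace (EuclideanSpace ℝ (Fin m)) N]
  [IsManifold (𝓡 m) ∞ N]

/-- Affine connections on `N`, i.e. covariant derivatives on the tangent bundle.
In Mathlib's argument order `∇_v Y` at `x` is `nabla Y x v`. -/
abbrev AffineConnection (m : ℕ) (N : Type*) [TopologicalSpace N]
    [ChartedSpace (EuclideanSpace ℝ (Fin m)) N] [IsManifold (𝓡 m) ∞ N] : Type _ :=
  CovariantDerivative (𝓡 m) (EuclideanSpace ℝ (Fin m))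
    (fun x : N => TangentSpace (𝓡 m) x)

set_option synthInstance.maxHeartbeats 400000 in
/-- `nabla` is the Levi-Civita connection of the Riemannian metric: metric and torsion-free. -/
structure IsLeviCivita [RiemannianBundle (fun x : N => TangentSpace (𝓡 m) x)]
    [IsContMDiffRiemannianBundle (𝓡 m) ∞ (EuclideanSpace ℝ (Fin m))
      (fun x : N => TangentSpace (𝓡 m) x)]
    (nabla : AffineConnection m N) : Prop where
  metric : nabla.IsMetricCompatible
  torsion_free : nabla.torsion = 0

/-- The curvature `R(X, Y) Z = ∇_X ∇_Y Z - ∇_Y ∇_X Z - ∇_[X,Y] Z` of vector fields. -/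
def curvatureOfFields (nabla : AffineConnection m N)
    (X Y Z : Π x : N, TangentSpace (𝓡 m) x) (x : N) : TangentSpace (𝓡 m) x :=
  nabla (fun y => nabla Z y (Y y)) x (X x) - nabla (fun y => nabla Z y (X y)) x (Y x)
    - nabla Z x (VectorField.mlieBracket (𝓡 m) X Y x)

/-- The curvature tensor `R(u, v) w` of tangent vectors at `x`, computed on extensions of
`u, v, w` to vector fields that are smooth near `x`. -/
def curvature (nabla : AffineConnection m N) (x : N) (u v w : TangentSpace (𝓡 m) x) :
    TangentSpace (𝓡 m) x :=
  curvatureOfFields nabla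
    (FiberBundle.extend (EuclideanSpace ℝ (Fin m)) u)
    (FiberBundle.extend (EuclideanSpace ℝ (Fin m)) v)
    (FiberBundle.extend (EuclideanSpace ℝ (Fin m)) w) x

/-- The sectional curvature of the plane spanned by `u` and `v`. -/
def sectionalCurvature [RiemannianBundle (fun x : N => TangentSpace (𝓡 m) x)]
    (nabla : AffineConnection m N) (x : N) (u v : TangentSpace (𝓡 m) x) : ℝ :=
  inner ℝ (curvature nabla x u v v) u / (‖u‖ ^ 2 * ‖v‖ ^ 2 - (inner ℝ u v) ^ 2)

end Connection

section Sasakian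

variable {m : ℕ} {N : Type*} [TopologicalSpace N] [ChartedSpace (EuclideanSpace ℝ (Fin m)) N]
  [IsManifold (𝓡 m) ∞ N] [RiemannianBundle (fun x : N => TangentSpace (𝓡 m) x)]

/-- The exterior derivative of a 1-form on vector fields, with the normalisation
`dη(X, Y) = (X (η Y) - Y (η X) - η [X, Y]) / 2` that is used in contact metric geometry. -/
def dOneForm (eta : Π x : N, TangentSpace (𝓡 m) x →L[ℝ] ℝ)
    (X Y : Π x : N, TangentSpace (𝓡 m) x) (x : N) : ℝ :=
  (mvfderiv (𝓡 m) (fun y => eta y (Y y)) x (X x)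
    - mvfderiv (𝓡 m) (fun y => eta y (X y)) x (Y x)
    - eta x (VectorField.mlieBracket (𝓡 m) X Y x)) / 2

/-- `(φ, ξ, η, g)` is a contact metric structure, `g` being the Riemannian metric of `N`. -/
structure IsContactMetric
    (phi : Π x : N, TangentSpace (𝓡 m) x →L[ℝ] TangentSpace (𝓡 m) x)
    (xi : Π x : N, TangentSpace (𝓡 m) x)
    (eta : Π x : N, TangentSpace (𝓡 m) x →L[ℝ] ℝ) : Prop where
  phi_smooth : ContMDiff (𝓡 m)
    ((𝓡 m).prod 𝓘(ℝ, EuclideanSpace ℝ (Fin m) →L[ℝ] EuclideanSpace ℝ (Fin m))) ∞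
    (fun x => TotalSpace.mk' (EuclideanSpace ℝ (Fin m) →L[ℝ] EuclideanSpace ℝ (Fin m))
      (E := fun x : N => TangentSpace (𝓡 m) x →L[ℝ] TangentSpace (𝓡 m) x) x (phi x))
  xi_smooth : ContMDiff (𝓡 m) (𝓡 m).tangent ∞
    (fun x => (⟨x, xi x⟩ : TangentBundle (𝓡 m) N))
  eta_smooth : ContMDiff (𝓡 m) ((𝓡 m).prod 𝓘(ℝ, EuclideanSpace ℝ (Fin m) →L[ℝ] ℝ)) ∞
    (fun x => TotalSpace.mk' (EuclideanSpace ℝ (Fin m) →L[ℝ] ℝ)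
      (E := fun x : N => TangentSpace (𝓡 m) x →L[ℝ] Bundle.Trivial N ℝ x) x (eta x))
  phi_sq : ∀ (x : N) (u : TangentSpace (𝓡 m) x), phi x (phi x u) = -u + eta x u • xi x
  eta_xi : ∀ x : N, eta x (xi x) = 1
  compatible : ∀ (x : N) (u v : TangentSpace (𝓡 m) x),
    inner ℝ (phi x u) (phi x v) = inner ℝ u v - eta x u * eta x v
  d_eta : ∀ (x : N) (X Y : Π y : N, TangentSpace (𝓡 m) y),
    MDifferentiableAt (𝓡 m) (𝓡 m).tangent (fun y => (⟨y, X y⟩ : TangentBundle (𝓡 m) N)) x →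
    MDifferentiableAt (𝓡 m) (𝓡 m).tangent (fun y => (⟨y, Y y⟩ : TangentBundle (𝓡 m) N)) x →
    inner ℝ (X x) (phi x (Y x)) = dOneForm eta X Y x

/-- A Sasakian structure: a contact metric structure with
`(∇_u φ) Y = g(u, Y) ξ - η(Y) u`, where `(∇_u φ) Y = ∇_u (φ Y) - φ (∇_u Y)` and `nabla` is the
Levi-Civita connection. -/
structure IsSasakian (nabla : AffineConnection m N)
    (phi : Π x : N, TangentSpace (𝓡 m) x →L[ℝ] TangentSpace (𝓡 m) x)
    (xi : Π x : N, TangentSpace (𝓡 m) x)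
    (eta : Π x : N, TangentSpace (𝓡 m) x →L[ℝ] ℝ) : Prop
    extends IsContactMetric phi xi eta where
  nabla_phi : ∀ (x : N) (u : TangentSpace (𝓡 m) x) (Y : Π y : N, TangentSpace (𝓡 m) y),
    MDifferentiableAt (𝓡 m) (𝓡 m).tangent (fun y => (⟨y, Y y⟩ : TangentBundle (𝓡 m) N)) x →
    nabla (fun y => phi y (Y y)) x u - phi x (nabla Y x u)
      = (inner ℝ u (Y x) : ℝ) • xi x - eta x (Y x) • u

/-- A Sasakian space form `N(c)`: all `φ`-sectional curvatures are equal to `c`. -/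
structure IsSasakianSpaceForm (nabla : AffineConnection m N)
    (phi : Π x : N, TangentSpace (𝓡 m) x →L[ℝ] TangentSpace (𝓡 m) x)
    (xi : Π x : N, TangentSpace (𝓡 m) x)
    (eta : Π x : N, TangentSpace (𝓡 m) x →L[ℝ] ℝ) (c : ℝ) : Prop
    extends IsSasakian nabla phi xi eta where
  phi_sectional : ∀ (x : N) (u : TangentSpace (𝓡 m) x), ‖u‖ = 1 → inner ℝ u (xi x) = 0 →
    sectionalCurvature nabla x u (phi x u) = c

end Sasakian

section Curves

variable {m : ℕ} {N : Type*} [TopologicalSpace N] [ChartedSpace (EuclideanSpace ℝ (Fin m)) N]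
  [IsManifold (𝓡 m) ∞ N]

/-- The velocity `γ'(t)`. -/
def velocity (γ : ℝ → N) (t : ℝ) : TangentSpace (𝓡 m) (γ t) :=
  mfderiv 𝓘(ℝ, ℝ) (𝓡 m) γ t (1 : ℝ)

/-- The covariant derivative `∇_T V` of a vector field `V` along `γ`. In the local frame `(σ_i)`
of the tangent bundle that comes from the chart at `γ t`, one has `V = ∑ vⁱ (σ_i ∘ γ)` near `t`,
and `∇_T V = ∑ ((vⁱ)' σ_i + vⁱ ∇_{γ'} σ_i)`. The two terms below are these two sums at `t`
(`FiberBundle.extend` extends `V t` with constant components in this frame). -/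
def covDerivAlong (nabla : AffineConnection m N) (γ : ℝ → N)
    (V : Π t : ℝ, TangentSpace (𝓡 m) (γ t)) (t : ℝ) : TangentSpace (𝓡 m) (γ t) :=
  (trivializationAt (EuclideanSpace ℝ (Fin m)) (fun x : N => TangentSpace (𝓡 m) x) (γ t)).symm
      (γ t)
      (deriv (fun s => (trivializationAt (EuclideanSpace ℝ (Fin m))
        (fun x : N => TangentSpace (𝓡 m) x) (γ t)
          (⟨γ s, V s⟩ : TangentBundle (𝓡 m) N)).2) t)
    + nabla (FiberBundle.extend (EuclideanSpace ℝ (Fin m)) (V t)) (γ t) (velocity γ t)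

/-- The tension field `τ(γ) = ∇_T T` of a curve. -/
def tension (nabla : AffineConnection m N) (γ : ℝ → N) (t : ℝ) : TangentSpace (𝓡 m) (γ t) :=
  covDerivAlong nabla γ (velocity γ) t

/-- The bitension field `τ₂(γ) = -Δ τ(γ) - trace R(dγ, τ(γ)) dγ = ∇_T ∇_T τ(γ) - R(T, τ(γ)) T`
of a curve. -/
def bitension (nabla : AffineConnection m N) (γ : ℝ → N) (t : ℝ) : TangentSpace (𝓡 m) (γ t) :=
  covDerivAlong nabla γ (covDerivAlong nabla γ (tension nabla γ)) t
    - curvature nabla (γ t) (velocity γ t) (tension nabla γ t) (velocity γ t)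

/-- `γ : J → N` is harmonic. -/
def IsHarmonicOn (nabla : AffineConnection m N) (γ : ℝ → N) (J : Set ℝ) : Prop :=
  ∀ t ∈ J, tension nabla γ t = 0

/-- `γ : J → N` is biharmonic: it satisfies the Euler-Lagrange equation of the bienergy. -/
def IsBiharmonicOn (nabla : AffineConnection m N) (γ : ℝ → N) (J : Set ℝ) : Prop :=
  ∀ t ∈ J, bitension nabla γ t = 0

/-- Proper-biharmonic: biharmonic and not harmonic. -/
def IsProperBiharmonicOn (nabla : AffineConnection m N) (γ : ℝ → N) (J : Set ℝ) : Prop :=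
  IsBiharmonicOn nabla γ J ∧ ¬ IsHarmonicOn nabla γ J

variable [RiemannianBundle (fun x : N => TangentSpace (𝓡 m) x)]

/-- `γ : J → N` is a Frenet curve of osculating order `r`, with Frenet frame `E 1, …, E r` and
curvatures `κ 1, …, κ (r - 1)` (the values of `E` and `κ` at other indices are irrelevant).
`J` is meant to be an open interval. Arc length parametrisation is `‖E 1‖ = ‖γ'‖ = 1`. -/
structure IsFrenetFrame (nabla : AffineConnection m N) (γ : ℝ → N) (J : Set ℝ) (r : ℕ)
    (E : ℕ → Π t : ℝ, TangentSpace (𝓡 m) (γ t)) (κ : ℕ → ℝ → ℝ) : Prop where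
  smooth : ContMDiffOn 𝓘(ℝ, ℝ) (𝓡 m) ∞ γ J
  one_le : 1 ≤ r
  frame_smooth : ∀ i ∈ Finset.Icc 1 r, ContMDiffOn 𝓘(ℝ, ℝ) (𝓡 m).tangent ∞
    (fun t => (⟨γ t, E i t⟩ : TangentBundle (𝓡 m) N)) J
  curvature_smooth : ∀ i ∈ Finset.Ico 1 r, ContDiffOn ℝ ∞ (κ i) J
  curvature_pos : ∀ i ∈ Finset.Ico 1 r, ∀ t ∈ J, 0 < κ i t
  orthonormal : ∀ i ∈ Finset.Icc 1 r, ∀ j ∈ Finset.Icc 1 r, ∀ t ∈ J,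
    inner ℝ (E i t) (E j t) = if i = j then (1 : ℝ) else 0
  first : ∀ t ∈ J, E 1 t = velocity γ t
  frenet : ∀ i ∈ Finset.Icc 1 r, ∀ t ∈ J,
    covDerivAlong nabla γ (E i) t
      = (if 1 < i then -(κ (i - 1) t • E (i - 1) t) else 0)
        + (if i < r then κ i t • E (i + 1) t else 0)

/-- `γ : J → N` is a Frenet curve of osculating order `r`. -/
def IsFrenetCurve (nabla : AffineConnection m N) (γ : ℝ → N) (J : Set ℝ) (r : ℕ) : Prop :=
  ∃ E κ, IsFrenetFrame nabla γ J r E κ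

/-- `γ` is a circle with (constant) curvature `k₁`. -/
def IsCircle (nabla : AffineConnection m N) (γ : ℝ → N) (J : Set ℝ) (k₁ : ℝ) : Prop :=
  ∃ E κ, IsFrenetFrame nabla γ J 2 E κ ∧ ∀ t ∈ J, κ 1 t = k₁

/-- `γ` is a helix (of order 3) with (constant) curvatures `k₁` and `k₂`. -/
def IsHelix (nabla : AffineConnection m N) (γ : ℝ → N) (J : Set ℝ) (k₁ k₂ : ℝ) : Prop :=
  ∃ E κ, IsFrenetFrame nabla γ J 3 E κ ∧ ∀ t ∈ J, κ 1 t = k₁ ∧ κ 2 t = k₂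

end Curves

/-- Two vectors are parallel if they are linearly dependent. -/
def AreParallel {V : Type*} [AddCommGroup V] [Module ℝ V] (u v : V) : Prop :=
  ∃ a b : ℝ, (a ≠ 0 ∨ b ≠ 0) ∧ a • u = b • v

end SasakianCurves

end

namespace SasakianCurves

/-! Everything rests on one curvature identity: for a unit vector T of a Sasakian space form, R(T,
φT)T = -(c - (c - 1) η(T)²) φT (`IsSasakianSpaceForm.curvature_apply_phi_self`). Constant
φ-sectional curvature fixes the quartic form g(R(u, φu)φu, u) on u ⊥ ξ. Polarising it with the
Sasakian symmetries gives the vector R(u, φu)φu, and the ξ-part of T enters through R(X, Y)ξ = η(Y)X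
- η(X)Y.

The assumption ∇_T T ∥ φT acts twice. Since ∇ξ = -φ, the derivative of η(T) is g(∇_T T, ξ), which
vanishes, so η(T) is constant (`hasDerivAt_eta_velocity`). If the order is at least 2, then η(T)² ≠
1, because a curve with T = ±ξ is a geodesic (`eta_velocity_sq_ne_one`). Hence φT ≠ 0, κ₁E₂ is a
multiple of φT, and the curvature term of τ₂ is a multiple of E₂ (`bitension_eq`).

Biharmonicity can now be read off in the Frenet frame (`curvature_equations`). The E₁-component
gives κ₁' = 0, the E₃-component κ₂' = 0, the E₄-component forbids order 4 or more, and the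
E₂-component becomes κ₁² + κ₂² = c - (c - 1) η(T)², with κ₂ absent in order 2. These conditions also
suffice (`bitension_eq_zero`).

The remaining lemmas are the Riemannian background: symmetries and tensoriality of the curvature,
the curvature identities of a Sasakian manifold, and the calculus of ∇_T along a curve. -/

/-- The pair symmetry of a function with the symmetries of a curvature tensor. -/
theorem pair_symmetry_of_bianchi {α : Type*} (B : α → α → α → α → ℝ)
    (antisymm : ∀ a b c d, B a b c d = -B b a c d)
    (skew : ∀ a b c d, B a b c d = -B a b d c)
    (bianchi : ∀ a b c d, B a b c d + B b c a d + B c a b d = 0) (a b c d : α) :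
    B a b c d = B c d a b := by
  have h1 := bianchi a b c d
  have h2 := bianchi b c d a
  have h3 := bianchi c d a b
  have h4 := bianchi d a b c
  linarith [antisymm b c d a, skew b c a d, antisymm c d a b, skew c d a b, skew d b c a,
    antisymm d b c a, antisymm c a b d, skew c a b d, antisymm a c d b, skew a c d b,
    antisymm a c b d, skew a c b d, antisymm d a c b, skew d a c b, antisymm d a b c, skew d a b c,
    antisymm a b c d, skew a b c d, skew a b d c, antisymm a d b c, antisymm b d a c, skew b d a c,
    antisymm b d c a]

/-! ### Pointwise algebra of the curvature tensor of a Sasakian space form. -/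

section Algebra

variable {V : Type*} [NormedAddCommGroup V] [InnerProductSpace ℝ V]

/-- The algebraic symmetries of the curvature tensor of a Riemannian manifold. -/
structure IsCurvatureLike (R : V → V → V → V) : Prop where
  antisymm : ∀ u v w, R u v w = -R v u w
  skew : ∀ u v w z, (inner ℝ (R u v w) z : ℝ) = -inner ℝ (R u v z) w
  bianchi : ∀ u v w, R u v w + R v w u + R w u v = 0

/-- The algebraic properties of the tensors of an almost contact metric structure. -/
structure IsAlmostContactMetric (φ : V → V) (ξ : V) (η : V → ℝ) : Prop where
  map_add : ∀ u v, φ (u + v) = φ u + φ v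
  map_smul : ∀ (a : ℝ) u, φ (a • u) = a • φ u
  eta_eq : ∀ u, η u = inner ℝ u ξ
  sq : ∀ u, φ (φ u) = -u + η u • ξ
  eta_xi : η ξ = 1
  compatible : ∀ u v, (inner ℝ (φ u) (φ v) : ℝ) = inner ℝ u v - η u * η v

namespace IsCurvatureLike

variable {R : V → V → V → V} (hR : IsCurvatureLike R)
include hR

theorem pair (u v w z : V) : (inner ℝ (R u v w) z : ℝ) = inner ℝ (R w z u) v := by
  refine pair_symmetry_of_bianchi (fun u v w z => (inner ℝ (R u v w) z : ℝ)) ?_ hR.skew ?_ u v w z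
  · intro a b c d
    simp only [hR.antisymm a b c, inner_neg_left]
  · intro a b c d
    simp only [← inner_add_left, hR.bianchi, inner_zero_left]

/-- Multilinearity is not part of `IsCurvatureLike`. It is automatic: `skew` moves the third
argument into an inner product, `pair` carries the result to the first slot, and `antisymm` to the
second. -/
theorem add_three (u v w w' : V) : R u v (w + w') = R u v w + R u v w' := by
  refine ext_inner_right ℝ fun z => ?_
  rw [inner_add_left, hR.skew, inner_add_right, hR.skew u v w, hR.skew u v w']
  ring

theorem smul_three (a : ℝ) (u v w : V) : R u v (a • w) = a • R u v w := by
  refine ext_inner_right ℝ fun z => ?_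
  rw [real_inner_smul_left, hR.skew, real_inner_smul_right, hR.skew u v w]
  ring

theorem add_one (u u' v w : V) : R (u + u') v w = R u v w + R u' v w := by
  refine ext_inner_right ℝ fun z => ?_
  rw [inner_add_left, hR.pair, hR.add_three, inner_add_left, hR.pair u, hR.pair u']

theorem smul_one (a : ℝ) (u v w : V) : R (a • u) v w = a • R u v w := by
  refine ext_inner_right ℝ fun z => ?_
  rw [real_inner_smul_left, hR.pair, hR.smul_three, real_inner_smul_left, hR.pair u]

theorem add_two (u v v' w : V) : R u (v + v') w = R u v w + R u v' w := by
  rw [hR.antisymm, hR.add_one, hR.antisymm u v, hR.antisymm u v']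
  abel

theorem smul_two (a : ℝ) (u v w : V) : R u (a • v) w = a • R u v w := by
  rw [hR.antisymm, hR.smul_one, hR.antisymm u v, smul_neg]

end IsCurvatureLike

namespace IsAlmostContactMetric

variable {φ : V → V} {ξ : V} {η : V → ℝ} (hφ : IsAlmostContactMetric φ ξ η)
include hφ

theorem map_neg (u : V) : φ (-u) = -φ u := by
  rw [← neg_one_smul ℝ, hφ.map_smul, neg_one_smul]

theorem inner_xi_xi : (inner ℝ ξ ξ : ℝ) = 1 := by rw [← hφ.eta_eq, hφ.eta_xi]

theorem map_xi : φ ξ = 0 := by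
  have := hφ.compatible ξ ξ
  rw [hφ.inner_xi_xi, hφ.eta_xi, mul_one, sub_self] at this
  exact inner_self_eq_zero.mp this

/-- Compare the two ways of computing φ³u, as φ(φ²u) and as φ²(φu). -/
theorem eta_map (u : V) : η (φ u) = 0 := by
  have hξ : ξ ≠ 0 := by
    rintro rfl
    simpa using hφ.inner_xi_xi
  have h1 := hφ.sq (φ u)
  rw [hφ.sq u, hφ.map_add, hφ.map_neg, hφ.map_smul, hφ.map_xi, smul_zero, add_zero] at h1
  have h2 : η (φ u) • ξ = 0 := by simpa using h1.symm
  exact (smul_eq_zero.mp h2).resolve_right hξ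

theorem inner_map_left (u v : V) : (inner ℝ (φ u) v : ℝ) = -inner ℝ u (φ v) := by
  have h := hφ.compatible u (φ v)
  rw [hφ.sq, hφ.eta_map, inner_add_right, inner_neg_right, inner_smul_right, ← hφ.eta_eq (φ u),
    hφ.eta_map] at h
  linarith

theorem inner_map_self (u : V) : (inner ℝ (φ u) u : ℝ) = 0 := by
  have := hφ.inner_map_left u u
  rw [real_inner_comm] at this
  rw [real_inner_comm]
  linarith

end IsAlmostContactMetric

/-- The algebraic properties of the curvature tensor of a Sasakian manifold. -/
structure IsSasakianCurvature (R : V → V → V → V) (φ : V → V) (ξ : V) (η : V → ℝ) : Prop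
    extends IsCurvatureLike R where
  contact : IsAlmostContactMetric φ ξ η
  apply_xi : ∀ u v, R u v ξ = η v • u - η u • v
  apply_phi : ∀ u v w, R u v (φ w) = φ (R u v w) - (inner ℝ v w : ℝ) • φ u
    + (inner ℝ u w : ℝ) • φ v + (inner ℝ w (φ u) : ℝ) • v - (inner ℝ w (φ v) : ℝ) • u

namespace IsSasakianCurvature

variable {R : V → V → V → V} {φ : V → V} {ξ : V} {η : V → ℝ}
  (h : IsSasakianCurvature R φ ξ η) {c : ℝ}
  (hc : ∀ u, ‖u‖ = 1 → η u = 0 → (inner ℝ (R u (φ u) (φ u)) u : ℝ) = c)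
include h

/-- The derivative at u in the direction v of the quartic form g(R(u, φu)φu, u) has four terms. This
lemma and the next two show that for η(u) = 0 they all coincide with g(R(u, φu)φu, v). -/
theorem polarized_first (u v : V) :
    (inner ℝ (R v (φ u) (φ u)) u : ℝ) = inner ℝ (R u (φ u) (φ u)) v := by
  rw [h.pair, h.skew, h.antisymm, inner_neg_left, neg_neg]

theorem polarized_second (u v : V) :
    (inner ℝ (R u (φ v) (φ u)) u : ℝ) = inner ℝ (R u (φ u) (φ v)) u := by
  rw [h.pair, h.antisymm, inner_neg_left, h.skew u (φ u) (φ v)]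

theorem polarized_third (u v : V) (hu : η u = 0) :
    (inner ℝ (R u (φ u) (φ v)) u : ℝ) = inner ℝ (R u (φ u) (φ u)) v := by
  have hφ := h.contact
  rw [h.apply_phi]
  simp only [inner_sub_left, inner_add_left, real_inner_smul_left, hφ.inner_map_left (R _ _ _),
    hφ.inner_map_self, hφ.sq]
  have h2 := h.skew u (φ u) v (φ u)
  rw [inner_add_right, inner_neg_right, inner_smul_right, real_inner_comm (φ u) v, h2, hu,
    inner_neg_left, real_inner_comm u v]
  ring

include hc in
theorem phi_sectional_of_horizontal (u : V) (hu : η u = 0) :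
    (inner ℝ (R u (φ u) (φ u)) u : ℝ) = c * (inner ℝ u u : ℝ) ^ 2 := by
  have hφ := h.contact
  by_cases hu0 : u = 0
  · subst hu0
    simp
  have hn : ‖u‖ ≠ 0 := norm_ne_zero_iff.mpr hu0
  have h1 := hc (‖u‖⁻¹ • u) (by rw [norm_smul, norm_inv, norm_norm, inv_mul_cancel₀ hn])
    (by rw [hφ.eta_eq, real_inner_smul_left, ← hφ.eta_eq, hu, mul_zero])
  simp only [hφ.map_smul, h.smul_one, h.smul_two, h.smul_three, real_inner_smul_left,
    real_inner_smul_right] at h1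
  rw [real_inner_self_eq_norm_sq, ← h1]
  field_simp

include hc in
-- Both sides of g(R(u, φu)φu, u) = c|u|⁴ are differentiated in horizontal directions; the
-- ξ-component is computed from `apply_xi`.
theorem apply_phi_phi_of_horizontal (u : V) (hu : η u = 0) :
    R u (φ u) (φ u) = (c * (inner ℝ u u : ℝ)) • u := by
  have hφ := h.contact
  have key : ∀ v, η v = 0 →
      (inner ℝ (R u (φ u) (φ u)) v : ℝ) = c * (inner ℝ u u : ℝ) * inner ℝ u v := by
    intro v hv
    have hQ : ∀ t : ℝ, (inner ℝ (R (u + t • v) (φ (u + t • v)) (φ (u + t • v))) (u + t • v) : ℝ)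
        = c * (inner ℝ (u + t • v) (u + t • v) : ℝ) ^ 2 := fun t =>
      h.phi_sectional_of_horizontal hc _ (by
        rw [hφ.eta_eq, inner_add_left, real_inner_smul_left, ← hφ.eta_eq, ← hφ.eta_eq, hu, hv]
        simp)
    simp only [hφ.map_add, hφ.map_smul, h.add_one, h.add_two, h.add_three, h.smul_one, h.smul_two,
      h.smul_three, inner_add_left, inner_add_right, real_inner_smul_left, real_inner_smul_right]
      at hQ
    -- Along u + tv the identity is one between polynomials of degree 4 in t. Its linear coefficient
    -- is recovered exactly from t = ±1, ±2 by the difference formula with weights 2/3 and -1/12;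
    -- the factor 1/4 accounts for the four equal terms.
    have e1 := hQ 1
    have e2 := hQ (-1)
    have e3 := hQ 2
    have e4 := hQ (-2)
    have a1 := h.polarized_first u v
    have a2 := h.polarized_second u v
    have a3 := h.polarized_third u v hu
    rw [real_inner_comm u v] at e1 e2 e3 e4
    linear_combination (1/4) * ((2/3) * (e1 - e2) - (1/12) * (e3 - e4)) - (1/4) * (a1 + a2 + 2 * a3)
  refine ext_inner_right ℝ fun z => ?_
  have hz : z = (z - η z • ξ) + η z • ξ := by abel
  have h0 : η (z - η z • ξ) = 0 := by
    rw [hφ.eta_eq, inner_sub_left, real_inner_smul_left, hφ.inner_xi_xi, ← hφ.eta_eq]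
    ring
  rw [hz, inner_add_right, key _ h0, inner_smul_right, h.skew, h.apply_xi, hφ.eta_map, hu]
  rw [real_inner_smul_left, inner_add_right, inner_smul_right, ← hφ.eta_eq u, hu]
  simp

include hc in
-- This is the previous identity with φu in place of u, since φ²u = -u for horizontal u.
theorem apply_phi_self_of_horizontal (u : V) (hu : η u = 0) :
    R u (φ u) u = -(c * (inner ℝ u u : ℝ)) • φ u := by
  have hφ := h.contact
  have h1 := h.apply_phi_phi_of_horizontal hc (φ u) (hφ.eta_map u)
  have h2 : φ (φ u) = -u := by rw [hφ.sq, hu, zero_smul, add_zero]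
  have h3 : (inner ℝ (φ u) (φ u) : ℝ) = inner ℝ u u := by rw [hφ.compatible, hu]; ring
  rw [h2, h3, ← neg_one_smul ℝ u, h.smul_two, h.smul_three, smul_smul, h.antisymm] at h1
  rw [neg_smul, ← h1]
  simp

include hc in
/-- `R(T, φT)T` for a unit vector `T` of a Sasakian space form. -/
theorem apply_phi_self (u : V) (hu : ‖u‖ = 1) :
    R u (φ u) u = -(c - (c - 1) * η u ^ 2) • φ u := by
  have hφ := h.contact
  obtain ⟨w, hw⟩ : ∃ w, u = w + η u • ξ := ⟨u - η u • ξ, by abel⟩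
  have hw0 : η w = 0 := by
    have := congrArg (fun v => (inner ℝ v ξ : ℝ)) hw
    simp only [inner_add_left, real_inner_smul_left, hφ.inner_xi_xi] at this
    rw [hφ.eta_eq u, hφ.eta_eq] at *
    linarith
  have hphi : φ u = φ w := by
    rw [hw, hφ.map_add, hφ.map_smul, hφ.map_xi, smul_zero, add_zero]
  have hww : (inner ℝ w w : ℝ) = 1 - η u ^ 2 := by
    have h1 : (inner ℝ u u : ℝ) = 1 := by rw [real_inner_self_eq_norm_sq, hu]; norm_num
    rw [hw] at h1
    simp only [inner_add_left, inner_add_right, real_inner_smul_left, real_inner_smul_right,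
      hφ.inner_xi_xi, real_inner_comm w ξ, ← hφ.eta_eq w, hw0] at h1
    linarith
  have hξ1 : R ξ (φ w) w = 0 := by
    refine ext_inner_right ℝ fun z => ?_
    rw [h.pair, h.apply_xi, hw0, zero_smul, sub_zero, real_inner_smul_left, real_inner_comm,
      hφ.inner_map_self]
    simp
  have hξ2 : R ξ (φ w) ξ = -φ w := by
    rw [h.apply_xi, hφ.eta_map, hφ.eta_xi]
    simp
  have hξ3 : R w (φ w) ξ = 0 := by
    rw [h.apply_xi, hφ.eta_map, hw0]
    simp
  rw [hphi]
  generalize η u = f at *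
  subst hw
  -- With u = w + fξ the mixed terms vanish, the horizontal term gives -c(1 - f²)φw and the ξ-term
  -- gives -f²φw.
  rw [h.add_one, h.add_three, h.add_three, h.smul_one, h.smul_one, h.smul_three, h.smul_three,
    hξ1, hξ2, hξ3, h.apply_phi_self_of_horizontal hc w hw0, hww]
  module

end IsSasakianCurvature

end Algebra

end SasakianCurves

/-! ### Smooth vector fields and the Levi-Civita connection. -/

namespace SasakianCurves

section Fields

open Filter Topology VectorField

variable {m : ℕ} {N : Type*} [TopologicalSpace N] [ChartedSpace (EuclideanSpace ℝ (Fin m)) N]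
  [IsManifold (𝓡 m) ∞ N]

/-- Smooth vector fields. -/
def IsSmoothField (X : Π x : N, TangentSpace (𝓡 m) x) : Prop :=
  ContMDiff (𝓡 m) (𝓡 m).tangent ∞ (fun x => (⟨x, X x⟩ : TangentBundle (𝓡 m) N))

namespace IsSmoothField

variable {X Y Z : Π x : N, TangentSpace (𝓡 m) x}

theorem mdifferentiableAt (hX : IsSmoothField X) (x : N) :
    MDifferentiableAt (𝓡 m) (𝓡 m).tangent (fun y => (⟨y, X y⟩ : TangentBundle (𝓡 m) N)) x :=
  (ContMDiff.mdifferentiable hX (by simp)) x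

theorem mdifferentiableAt_congr {X' : Π x : N, TangentSpace (𝓡 m) x} (hX : IsSmoothField X) {x : N}
    (h : X' =ᶠ[𝓝 x] X) :
    MDifferentiableAt (𝓡 m) (𝓡 m).tangent (fun y => (⟨y, X' y⟩ : TangentBundle (𝓡 m) N)) x :=
  (hX.mdifferentiableAt x).congr_of_eventuallyEq (h.mono fun y hy => by simp [hy])

theorem add (hX : IsSmoothField X) (hY : IsSmoothField Y) : IsSmoothField (X + Y) :=
  ContMDiff.add_section hX hY

theorem sub (hX : IsSmoothField X) (hY : IsSmoothField Y) : IsSmoothField (X - Y) :=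
  ContMDiff.sub_section hX hY

theorem smul {f : N → ℝ} (hf : ContMDiff (𝓡 m) 𝓘(ℝ, ℝ) ∞ f) (hX : IsSmoothField X) :
    IsSmoothField (f • X) :=
  ContMDiff.smul_section hf hX

theorem nabla {nabla : AffineConnection m N}
    [CovariantDerivative.ContMDiffCovariantDerivative nabla ∞]
    (hX : IsSmoothField X) (hY : IsSmoothField Y) : IsSmoothField (fun x => nabla Y x (X x)) := by
  have h := (CovariantDerivative.ContMDiffCovariantDerivative.contMDiff (cov := nabla)
    (k := ∞)).contMDiff (σ := Y) (ContMDiff.contMDiffOn hY)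
  rw [contMDiffOn_univ] at h
  exact ContMDiff.clm_bundle_apply h hX

end IsSmoothField

/-- A vector field which is smooth near a point agrees near this point with a smooth one. -/
theorem exists_isSmoothField_eventuallyEq [T2Space N] {x : N} {Y : Π x : N, TangentSpace (𝓡 m) x}
    {s : Set N} (hs : s ∈ 𝓝 x) (hY : ContMDiffOn (𝓡 m) (𝓡 m).tangent ∞
      (fun x => (⟨x, Y x⟩ : TangentBundle (𝓡 m) N)) s) :
    ∃ X, IsSmoothField X ∧ Y =ᶠ[𝓝 x] X := by
  obtain ⟨f, -, hf⟩ := (SmoothBumpFunction.nhds_basis_tsupport (I := 𝓡 m) x).mem_iff.mp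
    (interior_mem_nhds.mpr hs)
  refine ⟨(f : N → ℝ) • Y, ?_, ?_⟩
  · exact ContMDiffOn.smul_section_of_tsupport f.contMDiff.contMDiffOn isOpen_interior hf
      (hY.mono interior_subset)
  · filter_upwards [f.eventuallyEq_one] with y hy
    change Y y = f y • Y y
    rw [hy, Pi.one_apply, one_smul]

/-- The extensions used in `curvature` are smooth only near x. Replacing them by global smooth
fields with the same germ lets all later computations avoid domains. -/
theorem exists_isSmoothField_eventuallyEq_extend [T2Space N] {x : N} (u : TangentSpace (𝓡 m) x) :
    ∃ X, IsSmoothField X ∧ X x = u ∧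
      FiberBundle.extend (EuclideanSpace ℝ (Fin m)) (E := fun x : N => TangentSpace (𝓡 m) x) u
        =ᶠ[𝓝 x] X := by
  obtain ⟨s, hs, h⟩ := FiberBundle.exists_contMDiffOn_extend (k := ∞) (𝓡 m)
    (EuclideanSpace ℝ (Fin m)) (V := fun x : N => TangentSpace (𝓡 m) x) u
  obtain ⟨X, hX, h'⟩ := exists_isSmoothField_eventuallyEq hs h
  refine ⟨X, hX, ?_, h'⟩
  rw [← h'.self_of_nhds]
  exact FiberBundle.extend_apply_self (EuclideanSpace ℝ (Fin m))
    (E := fun x : N => TangentSpace (𝓡 m) x) u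

section Connection

variable {nabla : AffineConnection m N} {X Y Z : Π x : N, TangentSpace (𝓡 m) x}

theorem nabla_congr {X' : Π x : N, TangentSpace (𝓡 m) x} (hX : IsSmoothField X) {x : N}
    (h : X' =ᶠ[𝓝 x] X) : nabla X' x = nabla X x :=
  nabla.isCovariantDerivativeOnUniv.congr_of_eventuallyEq (hX.mdifferentiableAt_congr h)
    (hX.mdifferentiableAt x) univ_mem h

theorem nabla_add (hX : IsSmoothField X) (hY : IsSmoothField Y) (x : N) :
    nabla (X + Y) x = nabla X x + nabla Y x :=
  nabla.isCovariantDerivativeOnUniv.add (hX.mdifferentiableAt x) (hY.mdifferentiableAt x)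

theorem nabla_smul {f : N → ℝ} (hf : ContMDiff (𝓡 m) 𝓘(ℝ, ℝ) ∞ f) (hX : IsSmoothField X) (x : N)
    (u : TangentSpace (𝓡 m) x) :
    nabla (f • X) x u = f x • nabla X x u + mvfderiv (𝓡 m) f x u • X x := by
  rw [nabla.isCovariantDerivativeOnUniv.leibniz (hX.mdifferentiableAt x)
    (hf.mdifferentiable (by simp) x)]
  simp

theorem nabla_sub (hX : IsSmoothField X) (hY : IsSmoothField Y) (x : N) :
    nabla (X - Y) x = nabla X x - nabla Y x := by
  have h := nabla_add (nabla := nabla) (hX.sub hY) hY x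
  rw [sub_add_cancel] at h
  rw [h, add_sub_cancel_right]

variable [RiemannianBundle (fun x : N => TangentSpace (𝓡 m) x)]
    [IsContMDiffRiemannianBundle (𝓡 m) ∞ (EuclideanSpace ℝ (Fin m))
      (fun x : N => TangentSpace (𝓡 m) x)]

theorem IsSmoothField.inner (hX : IsSmoothField X) (hY : IsSmoothField Y) :
    ContMDiff (𝓡 m) 𝓘(ℝ, ℝ) ∞ (fun x => (inner ℝ (X x) (Y x) : ℝ)) :=
  ContMDiff.inner_bundle (F := EuclideanSpace ℝ (Fin m))
    (E := fun x : N => TangentSpace (𝓡 m) x) hX hY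

omit [IsManifold (𝓡 m) ∞ N] in
theorem tangent_ext {x : N} {u v : TangentSpace (𝓡 m) x}
    (h : ∀ w : TangentSpace (𝓡 m) x, (inner ℝ u w : ℝ) = inner ℝ v w) : u = v :=
  ext_inner_right ℝ h

theorem isContMDiffRiemannianBundle_one : IsContMDiffRiemannianBundle (𝓡 m) 1
    (EuclideanSpace ℝ (Fin m)) (fun x : N => TangentSpace (𝓡 m) x) :=
  IsContMDiffRiemannianBundle.of_le (n := ∞) (by simp)

namespace IsLeviCivita

variable (hnabla : IsLeviCivita nabla)
include hnabla

theorem mlieBracket_eq (hX : IsSmoothField X) (hY : IsSmoothField Y) :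
    mlieBracket (𝓡 m) X Y = (fun x => nabla Y x (X x)) - fun x => nabla X x (Y x) := by
  ext1 x
  exact (nabla.torsion_eq_zero_iff.mp hnabla.torsion_free (hX.mdifferentiableAt x)
    (hY.mdifferentiableAt x)).symm

theorem mvfderiv_inner (hX : IsSmoothField X) (hY : IsSmoothField Y) (x : N)
    (u : TangentSpace (𝓡 m) x) :
    mvfderiv (𝓡 m) (fun y => (inner ℝ (X y) (Y y) : ℝ)) x u
      = inner ℝ (nabla X x u) (Y x) + inner ℝ (X x) (nabla Y x u) := by
  have := isContMDiffRiemannianBundle_one (m := m) (N := N)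
  have := hnabla.metric.mvfderiv_inner_eq
    (FiberBundle.extend (EuclideanSpace ℝ (Fin m)) u)
    (hX.mdifferentiableAt x) (hY.mdifferentiableAt x)
  simpa using this

end IsLeviCivita

end Connection

end Fields

end SasakianCurves

/-! ### Symmetries and tensoriality of the curvature. -/

namespace SasakianCurves

section CurvatureOfFields

open Filter Topology VectorField

variable {m : ℕ} {N : Type*} [TopologicalSpace N] [ChartedSpace (EuclideanSpace ℝ (Fin m)) N]
  [IsManifold (𝓡 m) ∞ N]
  {nabla : AffineConnection m N} {X Y Z W : Π x : N, TangentSpace (𝓡 m) x}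

theorem curvatureOfFields_congr {X' Y' Z' : Π x : N, TangentSpace (𝓡 m) x}
    [CovariantDerivative.ContMDiffCovariantDerivative nabla ∞]
    (hX : IsSmoothField X) (hY : IsSmoothField Y) (hZ : IsSmoothField Z) {x : N}
    (hX' : X' =ᶠ[𝓝 x] X) (hY' : Y' =ᶠ[𝓝 x] Y) (hZ' : Z' =ᶠ[𝓝 x] Z) :
    curvatureOfFields nabla X' Y' Z' x = curvatureOfFields nabla X Y Z x := by
  have key : ∀ {X X' : Π x : N, TangentSpace (𝓡 m) x}, X' =ᶠ[𝓝 x] X →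
      (fun y => nabla Z' y (X' y)) =ᶠ[𝓝 x] fun y => nabla Z y (X y) := by
    intro X X' hX'
    filter_upwards [hX', eventually_eventually_nhds.mpr hZ'] with y hy hy'
    rw [hy, nabla_congr hZ hy']
  rw [curvatureOfFields, curvatureOfFields, nabla_congr (hY.nabla hZ) (key hY'),
    nabla_congr (hX.nabla hZ) (key hX'), nabla_congr hZ hZ', hX'.self_of_nhds, hY'.self_of_nhds,
    hX'.mlieBracket_vectorField_eq hY']

theorem curvatureOfFields_antisymm (x : N) :
    curvatureOfFields nabla X Y Z x = -curvatureOfFields nabla Y X Z x := by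
  rw [curvatureOfFields, curvatureOfFields, mlieBracket_swap, Pi.neg_apply, map_neg]
  abel

variable [RiemannianBundle (fun x : N => TangentSpace (𝓡 m) x)]
    [IsContMDiffRiemannianBundle (𝓡 m) ∞ (EuclideanSpace ℝ (Fin m))
      (fun x : N => TangentSpace (𝓡 m) x)]

namespace IsLeviCivita

variable (hnabla : IsLeviCivita nabla)
  [CovariantDerivative.ContMDiffCovariantDerivative nabla ∞]
include hnabla

theorem isSmoothField_mlieBracket (hX : IsSmoothField X) (hY : IsSmoothField Y) :
    IsSmoothField (mlieBracket (𝓡 m) X Y) := by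
  rw [hnabla.mlieBracket_eq hX hY]
  exact (hX.nabla hY).sub (hY.nabla hX)

omit hnabla [CovariantDerivative.ContMDiffCovariantDerivative nabla ∞]
  [RiemannianBundle (fun x : N => TangentSpace (𝓡 m) x)]
  [IsContMDiffRiemannianBundle (𝓡 m) ∞ (EuclideanSpace ℝ (Fin m))
      (fun x : N => TangentSpace (𝓡 m) x)] in
theorem _root_.SasakianCurves.IsSmoothField.jacobi (hX : IsSmoothField X) (hY : IsSmoothField Y)
    (hZ : IsSmoothField Z) (x : N) :
    mlieBracket (𝓡 m) X (mlieBracket (𝓡 m) Y Z) x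
      = mlieBracket (𝓡 m) (mlieBracket (𝓡 m) X Y) Z x
        + mlieBracket (𝓡 m) Y (mlieBracket (𝓡 m) X Z) x := by
  have h : (minSmoothness ℝ 2 : WithTop ℕ∞) ≤ ∞ := by
    rw [minSmoothness_of_isRCLikeNormedField]
    exact ENat.LEInfty.out
  have : IsManifold (𝓡 m) (minSmoothness ℝ 3) N := by
    rw [minSmoothness_of_isRCLikeNormedField]
    infer_instance
  exact leibniz_identity_mlieBracket_apply (hX.of_le h x) (hY.of_le h x) (hZ.of_le h x)

/-- With zero torsion, brackets are differences of covariant derivatives, and the Jacobi identity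
turns into the first Bianchi identity. -/
theorem curvatureOfFields_bianchi (hX : IsSmoothField X) (hY : IsSmoothField Y)
    (hZ : IsSmoothField Z) (x : N) :
    curvatureOfFields nabla X Y Z x + curvatureOfFields nabla Y Z X x
      + curvatureOfFields nabla Z X Y x = 0 := by
  have key : ∀ {X Y Z : Π x : N, TangentSpace (𝓡 m) x}, IsSmoothField X → IsSmoothField Y →
      IsSmoothField Z → mlieBracket (𝓡 m) X (mlieBracket (𝓡 m) Y Z) x
        = nabla (fun y => nabla Z y (Y y)) x (X x) - nabla (fun y => nabla Y y (Z y)) x (X x)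
          - nabla X x (mlieBracket (𝓡 m) Y Z x) := by
    intro X Y Z hX hY hZ
    rw [hnabla.mlieBracket_eq hX (hnabla.isSmoothField_mlieBracket hY hZ), Pi.sub_apply,
      hnabla.mlieBracket_eq hY hZ, nabla_sub (hY.nabla hZ) (hZ.nabla hY)]
    rfl
  have h := hX.jacobi hY hZ x
  rw [mlieBracket_swap_apply (V := mlieBracket (𝓡 m) X Y), mlieBracket_swap (V := X) (W := Z),
    show mlieBracket (𝓡 m) Y (-mlieBracket (𝓡 m) Z X) x
      = -mlieBracket (𝓡 m) Y (mlieBracket (𝓡 m) Z X) x by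
      rw [← neg_one_smul ℝ, mlieBracket_const_smul_right
        ((hnabla.isSmoothField_mlieBracket hZ hX).mdifferentiableAt x), neg_one_smul],
    key hX hY hZ, key hZ hX hY, key hY hZ hX] at h
  rw [curvatureOfFields, curvatureOfFields, curvatureOfFields]
  rw [← sub_eq_zero] at h
  rw [← h]
  abel

/-- `X (Y f) - Y (X f) = [X, Y] f`. -/
theorem mvfderiv_mlieBracket {f : N → ℝ} (hf : ContMDiff (𝓡 m) 𝓘(ℝ, ℝ) ∞ f)
    (hX : IsSmoothField X) (hY : IsSmoothField Y)
    (hfX : ContMDiff (𝓡 m) 𝓘(ℝ, ℝ) ∞ (fun y => mvfderiv (𝓡 m) f y (X y)))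
    (hfY : ContMDiff (𝓡 m) 𝓘(ℝ, ℝ) ∞ (fun y => mvfderiv (𝓡 m) f y (Y y))) (x : N)
    (hZ : IsSmoothField Z) (hZx : Z x ≠ 0) :
    mvfderiv (𝓡 m) (fun y => mvfderiv (𝓡 m) f y (Y y)) x (X x)
      - mvfderiv (𝓡 m) (fun y => mvfderiv (𝓡 m) f y (X y)) x (Y x)
      = mvfderiv (𝓡 m) f x (mlieBracket (𝓡 m) X Y x) := by
  have diff : ∀ {f : N → ℝ}, ContMDiff (𝓡 m) 𝓘(ℝ, ℝ) ∞ f →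
      MDifferentiableAt (𝓡 m) 𝓘(ℝ, ℝ) f x := fun hf => hf.mdifferentiable (by simp) x
  have key : ∀ {X Y : Π x : N, TangentSpace (𝓡 m) x}, IsSmoothField X → IsSmoothField Y →
      ContMDiff (𝓡 m) 𝓘(ℝ, ℝ) ∞ (fun y => mvfderiv (𝓡 m) f y (Y y)) →
      mlieBracket (𝓡 m) X (mlieBracket (𝓡 m) Y (f • Z)) x
        = mvfderiv (𝓡 m) (fun y => mvfderiv (𝓡 m) f y (Y y)) x (X x) • Z x
          + mvfderiv (𝓡 m) f x (Y x) • mlieBracket (𝓡 m) X Z x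
          + (mvfderiv (𝓡 m) f x (X x) • mlieBracket (𝓡 m) Y Z x
          + f x • mlieBracket (𝓡 m) X (mlieBracket (𝓡 m) Y Z) x) := by
    intro X Y hX hY hfY
    have hYZ := hnabla.isSmoothField_mlieBracket hY hZ
    have e : mlieBracket (𝓡 m) Y (f • Z)
        = (fun y => mvfderiv (𝓡 m) f y (Y y)) • Z + f • mlieBracket (𝓡 m) Y Z := by
      ext1 y
      exact mlieBracket_smul_right (hf.mdifferentiable (by simp) y) (hZ.mdifferentiableAt y)
    rw [e, mlieBracket_add_right ((hZ.smul hfY).mdifferentiableAt x)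
      ((hYZ.smul hf).mdifferentiableAt x), mlieBracket_smul_right (diff hfY)
      (hZ.mdifferentiableAt x), mlieBracket_smul_right (diff hf) (hYZ.mdifferentiableAt x)]
  -- Jacobi for X, Y, fZ, reduced by Jacobi for X, Y, Z, leaves only a multiple of Z. Its
  -- coefficient must vanish because Z does not vanish at x.
  have h := hX.jacobi hY (hZ.smul hf) x
  rw [key hX hY hfY, key hY hX hfX, mlieBracket_smul_right (diff hf) (hZ.mdifferentiableAt x),
    hX.jacobi hY hZ x] at h
  have h' : (mvfderiv (𝓡 m) (fun y => mvfderiv (𝓡 m) f y (Y y)) x (X x)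
      - mvfderiv (𝓡 m) (fun y => mvfderiv (𝓡 m) f y (X y)) x (Y x)
      - mvfderiv (𝓡 m) f x (mlieBracket (𝓡 m) X Y x)) • Z x = 0 := by
    rw [← sub_eq_zero] at h
    rw [← h]
    module
  exact sub_eq_zero.mp ((smul_eq_zero.mp h').resolve_right hZx)

/-- Apply XY - YX = [X, Y] to the function g(Z, W) and expand by metric compatibility: the terms
with one derivative on each of Z and W are symmetric in X and Y and cancel. -/
theorem curvatureOfFields_skew (hX : IsSmoothField X) (hY : IsSmoothField Y)
    (hZ : IsSmoothField Z) (hW : IsSmoothField W) (x : N) :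
    (inner ℝ (curvatureOfFields nabla X Y Z x) (W x) : ℝ)
      = -inner ℝ (Z x) (curvatureOfFields nabla X Y W x) := by
  by_cases hZx : Z x = 0 ∧ W x = 0
  · rw [hZx.1, hZx.2, inner_zero_left, inner_zero_right, neg_zero]
  -- `mvfderiv_mlieBracket` needs an auxiliary field that does not vanish at x; Z or W serves.
  obtain ⟨V, hV, hVx⟩ : ∃ V, IsSmoothField V ∧ V x ≠ 0 := by
    by_cases h : Z x = 0
    · exact ⟨W, hW, fun h' => hZx ⟨h, h'⟩⟩
    · exact ⟨Z, hZ, h⟩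
  have e : ∀ X : Π x : N, TangentSpace (𝓡 m) x,
      (fun y => mvfderiv (𝓡 m) (fun y => (inner ℝ (Z y) (W y) : ℝ)) y (X y))
        = (fun y => (inner ℝ (nabla Z y (X y)) (W y) : ℝ))
          + fun y => (inner ℝ (Z y) (nabla W y (X y)) : ℝ) := by
    intro X
    ext1 y
    exact hnabla.mvfderiv_inner hZ hW y (X y)
  have s : ∀ {X : Π x : N, TangentSpace (𝓡 m) x}, IsSmoothField X →
      ContMDiff (𝓡 m) 𝓘(ℝ, ℝ) ∞
        (fun y => mvfderiv (𝓡 m) (fun y => (inner ℝ (Z y) (W y) : ℝ)) y (X y)) := by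
    intro X hX
    rw [e X]
    exact ((hX.nabla hZ).inner hW).add (hZ.inner (hX.nabla hW))
  have d : ∀ {X Y : Π x : N, TangentSpace (𝓡 m) x}, IsSmoothField X → IsSmoothField Y →
      mvfderiv (𝓡 m)
        (fun y => mvfderiv (𝓡 m) (fun y => (inner ℝ (Z y) (W y) : ℝ)) y (Y y)) x (X x)
      = inner ℝ (nabla (fun y => nabla Z y (Y y)) x (X x)) (W x)
        + inner ℝ (nabla Z x (Y x)) (nabla W x (X x))
        + (inner ℝ (nabla Z x (X x)) (nabla W x (Y x))
        + inner ℝ (Z x) (nabla (fun y => nabla W y (Y y)) x (X x))) := by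
    intro X Y hX hY
    rw [e Y, mvfderiv_add (((hY.nabla hZ).inner hW).mdifferentiable (by simp) x)
      ((hZ.inner (hY.nabla hW)).mdifferentiable (by simp) x), add_apply,
      hnabla.mvfderiv_inner (hY.nabla hZ) hW, hnabla.mvfderiv_inner hZ (hY.nabla hW)]
  have h := hnabla.mvfderiv_mlieBracket (hZ.inner hW) hX hY (s hX) (s hY) x hV hVx
  rw [d hX hY, d hY hX, hnabla.mvfderiv_inner hZ hW] at h
  simp only [curvatureOfFields, inner_sub_left, inner_sub_right]
  linarith

theorem curvatureOfFields_pair (hX : IsSmoothField X) (hY : IsSmoothField Y)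
    (hZ : IsSmoothField Z) (hW : IsSmoothField W) (x : N) :
    (inner ℝ (curvatureOfFields nabla X Y Z x) (W x) : ℝ)
      = inner ℝ (curvatureOfFields nabla Z W X x) (Y x) := by
  refine pair_symmetry_of_bianchi
    (fun X Y Z W : {X : Π x : N, TangentSpace (𝓡 m) x // IsSmoothField X} =>
      (inner ℝ (curvatureOfFields nabla X.1 Y.1 Z.1 x) (W.1 x) : ℝ)) ?_ ?_ ?_
      ⟨X, hX⟩ ⟨Y, hY⟩ ⟨Z, hZ⟩ ⟨W, hW⟩
  · intro a b c d
    simp only [curvatureOfFields_antisymm (X := a.1) (Y := b.1), inner_neg_left]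
  · intro a b c d
    simp only [hnabla.curvatureOfFields_skew a.2 b.2 c.2 d.2 x, real_inner_comm (c.1 x)]
  · intro a b c d
    simp only [← inner_add_left, hnabla.curvatureOfFields_bianchi a.2 b.2 c.2, inner_zero_left]

variable [T2Space N]

/-- Tensoriality follows from the symmetries: by `curvatureOfFields_skew` the value depends on Z
only through Z x, pair symmetry gives the same for X, and antisymmetry for Y. -/
theorem curvatureOfFields_eq_of_eq {X' Y' Z' : Π x : N, TangentSpace (𝓡 m) x}
    (hX : IsSmoothField X) (hY : IsSmoothField Y) (hZ : IsSmoothField Z)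
    (hX' : IsSmoothField X') (hY' : IsSmoothField Y') (hZ' : IsSmoothField Z') {x : N}
    (eX : X x = X' x) (eY : Y x = Y' x) (eZ : Z x = Z' x) :
    curvatureOfFields nabla X Y Z x = curvatureOfFields nabla X' Y' Z' x := by
  have h3 : ∀ {X Y Z Z' : Π x : N, TangentSpace (𝓡 m) x}, IsSmoothField X → IsSmoothField Y →
      IsSmoothField Z → IsSmoothField Z' → Z x = Z' x →
      curvatureOfFields nabla X Y Z x = curvatureOfFields nabla X Y Z' x := by
    intro X Y Z Z' hX hY hZ hZ' e
    refine tangent_ext fun w => ?_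
    obtain ⟨W, hW, rfl, -⟩ := exists_isSmoothField_eventuallyEq_extend w
    rw [hnabla.curvatureOfFields_skew hX hY hZ hW, hnabla.curvatureOfFields_skew hX hY hZ' hW, e]
  have h1 : ∀ {X X' Y Z : Π x : N, TangentSpace (𝓡 m) x}, IsSmoothField X → IsSmoothField X' →
      IsSmoothField Y → IsSmoothField Z → X x = X' x →
      curvatureOfFields nabla X Y Z x = curvatureOfFields nabla X' Y Z x := by
    intro X X' Y Z hX hX' hY hZ e
    refine tangent_ext fun w => ?_
    obtain ⟨W, hW, rfl, -⟩ := exists_isSmoothField_eventuallyEq_extend w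
    rw [hnabla.curvatureOfFields_pair hX hY hZ hW, hnabla.curvatureOfFields_pair hX' hY hZ hW,
      h3 hZ hW hX hX' e]
  rw [h3 hX hY hZ hZ' eZ, h1 hX hX' hY hZ' eX, curvatureOfFields_antisymm,
    h1 hY hY' hX' hZ' eY, ← curvatureOfFields_antisymm]

theorem curvature_eq (hX : IsSmoothField X) (hY : IsSmoothField Y) (hZ : IsSmoothField Z) (x : N) :
    curvature nabla x (X x) (Y x) (Z x) = curvatureOfFields nabla X Y Z x := by
  obtain ⟨X', hX', eX, fX⟩ := exists_isSmoothField_eventuallyEq_extend (X x)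
  obtain ⟨Y', hY', eY, fY⟩ := exists_isSmoothField_eventuallyEq_extend (Y x)
  obtain ⟨Z', hZ', eZ, fZ⟩ := exists_isSmoothField_eventuallyEq_extend (Z x)
  rw [curvature, curvatureOfFields_congr hX' hY' hZ' fX fY fZ]
  exact hnabla.curvatureOfFields_eq_of_eq hX' hY' hZ' hX hY hZ eX eY eZ

theorem isCurvatureLike (x : N) : IsCurvatureLike (V := TangentSpace (𝓡 m) x)
    (curvature nabla x) where
  antisymm u v w := by
    obtain ⟨X, hX, rfl, -⟩ := exists_isSmoothField_eventuallyEq_extend u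
    obtain ⟨Y, hY, rfl, -⟩ := exists_isSmoothField_eventuallyEq_extend v
    obtain ⟨Z, hZ, rfl, -⟩ := exists_isSmoothField_eventuallyEq_extend w
    rw [hnabla.curvature_eq hX hY hZ, hnabla.curvature_eq hY hX hZ, curvatureOfFields_antisymm]
  skew u v w z := by
    obtain ⟨X, hX, rfl, -⟩ := exists_isSmoothField_eventuallyEq_extend u
    obtain ⟨Y, hY, rfl, -⟩ := exists_isSmoothField_eventuallyEq_extend v
    obtain ⟨Z, hZ, rfl, -⟩ := exists_isSmoothField_eventuallyEq_extend w
    obtain ⟨W, hW, rfl, -⟩ := exists_isSmoothField_eventuallyEq_extend z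
    rw [hnabla.curvature_eq hX hY hZ, hnabla.curvature_eq hX hY hW,
      hnabla.curvatureOfFields_skew hX hY hZ hW, real_inner_comm]
  bianchi u v w := by
    obtain ⟨X, hX, rfl, -⟩ := exists_isSmoothField_eventuallyEq_extend u
    obtain ⟨Y, hY, rfl, -⟩ := exists_isSmoothField_eventuallyEq_extend v
    obtain ⟨Z, hZ, rfl, -⟩ := exists_isSmoothField_eventuallyEq_extend w
    rw [hnabla.curvature_eq hX hY hZ, hnabla.curvature_eq hY hZ hX, hnabla.curvature_eq hZ hX hY,
      hnabla.curvatureOfFields_bianchi hX hY hZ]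

end IsLeviCivita

end CurvatureOfFields

end SasakianCurves

/-! ### Curvature identities of a Sasakian manifold. -/

namespace SasakianCurves

theorem IsAlmostContactMetric.of_compatible {V : Type*} [NormedAddCommGroup V]
    [InnerProductSpace ℝ V] {φ : V →L[ℝ] V} {ξ : V} {η : V →L[ℝ] ℝ}
    (sq : ∀ u, φ (φ u) = -u + η u • ξ) (eta_xi : η ξ = 1)
    (compatible : ∀ u v, (inner ℝ (φ u) (φ v) : ℝ) = inner ℝ u v - η u * η v) :
    IsAlmostContactMetric φ ξ η := by
  have h1 : φ (φ ξ) = 0 := by rw [sq, eta_xi, one_smul, neg_add_cancel]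
  have h2 : φ ξ = η (φ ξ) • ξ := by
    have := sq (φ ξ)
    rw [h1, φ.map_zero] at this
    exact neg_add_eq_zero.mp this.symm
  -- φξ is a multiple of ξ that φ kills, so either the factor or φξ itself is zero. Compatibility
  -- with v = ξ then yields η = g(·, ξ).
  have h3 : φ ξ = 0 := by
    have h := h1
    rw [h2, φ.map_smul, smul_eq_zero] at h
    rcases h with h | h
    · rw [h2, h, zero_smul]
    · exact h
  refine ⟨φ.map_add, φ.map_smul, fun u => ?_, sq, eta_xi, compatible⟩
  have := compatible u ξ
  rw [h3, inner_zero_right, eta_xi] at this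
  linarith

section Sasakian

open Filter Topology VectorField

variable {m : ℕ} {N : Type*} [TopologicalSpace N] [ChartedSpace (EuclideanSpace ℝ (Fin m)) N]
  [IsManifold (𝓡 m) ∞ N]
  {nabla : AffineConnection m N} {X Y Z W : Π x : N, TangentSpace (𝓡 m) x}
  [RiemannianBundle (fun x : N => TangentSpace (𝓡 m) x)]
  {phi : Π x : N, TangentSpace (𝓡 m) x →L[ℝ] TangentSpace (𝓡 m) x}
  {xi : Π x : N, TangentSpace (𝓡 m) x}
  {eta : Π x : N, TangentSpace (𝓡 m) x →L[ℝ] ℝ}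

theorem IsContactMetric.isAlmostContactMetric (h : IsContactMetric phi xi eta) (x : N) :
    IsAlmostContactMetric (V := TangentSpace (𝓡 m) x) (phi x) (xi x) (eta x) :=
  IsAlmostContactMetric.of_compatible (h.phi_sq x) (h.eta_xi x) (h.compatible x)

theorem IsContactMetric.isSmoothField_phi (h : IsContactMetric phi xi eta) (hX : IsSmoothField X) :
    IsSmoothField (fun x => phi x (X x)) :=
  ContMDiff.clm_bundle_apply h.phi_smooth hX

variable [IsContMDiffRiemannianBundle (𝓡 m) ∞ (EuclideanSpace ℝ (Fin m))
      (fun x : N => TangentSpace (𝓡 m) x)]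

/-- Put Y = ξ in the formula for ∇φ: as φξ = 0, it reads -φ(∇_u ξ) = η(u)ξ - u. Apply φ and use that
∇_u ξ ⊥ ξ, because |ξ| = 1. -/
theorem IsSasakian.nabla_xi (h : IsSasakian nabla phi xi eta) (hnabla : IsLeviCivita nabla) (x : N)
    (u : TangentSpace (𝓡 m) x) : nabla xi x u = -phi x u := by
  have hφ := h.isAlmostContactMetric
  have hxi : IsSmoothField xi := h.xi_smooth
  have h1 := h.nabla_phi x u xi (hxi.mdifferentiableAt x)
  have h2 : nabla (fun y => phi y (xi y)) x = 0 := by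
    have : (fun y => phi y (xi y)) = 0 := by
      ext1 y
      exact (hφ y).map_xi
    rw [this, nabla.zero]
    rfl
  have h3 := hnabla.mvfderiv_inner hxi hxi x u
  have h4 : (fun y => (inner ℝ (xi y) (xi y) : ℝ)) = fun _ => 1 := by
    ext1 y
    exact (hφ y).inner_xi_xi
  rw [h4, mvfderiv_const, zero_apply, real_inner_comm (nabla xi x u) (xi x)] at h3
  have h5 : eta x (nabla xi x u) = 0 := by
    rw [(hφ x).eta_eq]
    linarith
  rw [h2, zero_apply, zero_sub, h.eta_xi, one_smul, ← (hφ x).eta_eq] at h1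
  have h6 := congrArg (phi x) h1
  rw [(hφ x).map_neg, (hφ x).sq, h5, map_sub, map_smul, (hφ x).map_xi] at h6
  have h7 : nabla xi x u = eta x u • 0 - phi x u := by
    rw [← h6]
    simp
  rw [h7]
  simp

theorem IsSasakian.curvatureOfFields_xi (h : IsSasakian nabla phi xi eta)
    (hnabla : IsLeviCivita nabla) (hX : IsSmoothField X) (hY : IsSmoothField Y) (x : N) :
    curvatureOfFields nabla X Y xi x = eta x (Y x) • X x - eta x (X x) • Y x := by
  have key : ∀ {X Y : Π x : N, TangentSpace (𝓡 m) x}, IsSmoothField X → IsSmoothField Y →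
      nabla (fun y => nabla xi y (Y y)) x (X x)
      = -phi x (nabla Y x (X x)) - (inner ℝ (X x) (Y x) : ℝ) • xi x + eta x (Y x) • X x := by
    intro X Y hX hY
    have hY' := h.isSmoothField_phi hY
    have e : (fun y => nabla xi y (Y y)) = (-1 : ℝ) • fun y => phi y (Y y) := by
      ext1 y
      rw [Pi.smul_apply, neg_one_smul]
      exact h.nabla_xi hnabla y (Y y)
    have h1 := h.nabla_phi x (X x) Y (hY.mdifferentiableAt x)
    rw [e, nabla.isCovariantDerivativeOnUniv.smul_const _ (hY'.mdifferentiableAt x)]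
    rw [sub_eq_iff_eq_add] at h1
    change (-1 : ℝ) • nabla (fun y => phi y (Y y)) x (X x) = _
    rw [h1]
    module
  rw [curvatureOfFields, key hX hY, key hY hX, h.nabla_xi hnabla, hnabla.mlieBracket_eq hX hY,
    Pi.sub_apply, map_sub, real_inner_comm (X x)]
  module

variable [CovariantDerivative.ContMDiffCovariantDerivative nabla ∞]

/-- Differentiate the formula for ∇φ once more and antisymmetrise in X and Y. -/
theorem IsSasakian.curvatureOfFields_phi (h : IsSasakian nabla phi xi eta)
    (hnabla : IsLeviCivita nabla) (hX : IsSmoothField X) (hY : IsSmoothField Y)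
    (hZ : IsSmoothField Z) (x : N) :
    curvatureOfFields nabla X Y (fun y => phi y (Z y)) x
      = phi x (curvatureOfFields nabla X Y Z x) - (inner ℝ (Y x) (Z x) : ℝ) • phi x (X x)
        + (inner ℝ (X x) (Z x) : ℝ) • phi x (Y x) + (inner ℝ (Z x) (phi x (X x)) : ℝ) • Y x
        - (inner ℝ (Z x) (phi x (Y x)) : ℝ) • X x := by
  have hφ := h.isAlmostContactMetric
  have hxi : IsSmoothField xi := h.xi_smooth
  have key : ∀ {X Y : Π x : N, TangentSpace (𝓡 m) x}, IsSmoothField X → IsSmoothField Y →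
      nabla (fun y => nabla (fun y => phi y (Z y)) y (Y y)) x (X x)
      = phi x (nabla (fun y => nabla Z y (Y y)) x (X x))
        + (inner ℝ (X x) (nabla Z x (Y x)) : ℝ) • xi x - eta x (nabla Z x (Y x)) • X x
        + ((inner ℝ (nabla Y x (X x)) (Z x) : ℝ) + inner ℝ (Y x) (nabla Z x (X x))) • xi x
        - (inner ℝ (Y x) (Z x) : ℝ) • phi x (X x)
        - (eta x (nabla Z x (X x)) - inner ℝ (Z x) (phi x (X x))) • Y x
        - eta x (Z x) • nabla Y x (X x) := by
    intro X Y hX hY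
    have hYZ := hY.inner hZ
    have hZx := hZ.inner hxi
    -- Here η(Z) is written as g(Z, ξ), so that metric compatibility and ∇ξ = -φ give its
    -- derivative.
    have e : (fun y => nabla (fun y => phi y (Z y)) y (Y y))
        = (fun y => phi y (nabla Z y (Y y))) + ((fun y => (inner ℝ (Y y) (Z y) : ℝ)) • xi
          - (fun y => (inner ℝ (Z y) (xi y) : ℝ)) • Y) := by
      ext1 y
      have h1 := h.nabla_phi y (Y y) Z (hZ.mdifferentiableAt y)
      rw [sub_eq_iff_eq_add', (hφ y).eta_eq] at h1
      exact h1
    have h1 := h.nabla_phi x (X x) (fun y => nabla Z y (Y y)) ((hY.nabla hZ).mdifferentiableAt x)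
    rw [sub_eq_iff_eq_add'] at h1
    rw [e, nabla_add (h.isSmoothField_phi (hY.nabla hZ)) ((hxi.smul hYZ).sub (hY.smul hZx)),
      nabla_sub (hxi.smul hYZ) (hY.smul hZx)]
    simp only [add_apply, sub_apply]
    rw [nabla_smul hYZ hxi, nabla_smul hZx hY, h1, hnabla.mvfderiv_inner hY hZ,
      hnabla.mvfderiv_inner hZ hxi, h.nabla_xi hnabla, inner_neg_right, ← (hφ x).eta_eq,
      ← (hφ x).eta_eq]
    module
  have h1 := h.nabla_phi x (mlieBracket (𝓡 m) X Y x) Z (hZ.mdifferentiableAt x)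
  rw [sub_eq_iff_eq_add'] at h1
  rw [curvatureOfFields, key hX hY, key hY hX, h1, curvatureOfFields, map_sub, map_sub,
    hnabla.mlieBracket_eq hX hY, Pi.sub_apply, inner_sub_left]
  module

variable [T2Space N]

theorem IsSasakian.isSasakianCurvature (h : IsSasakian nabla phi xi eta)
    (hnabla : IsLeviCivita nabla) (x : N) :
    IsSasakianCurvature (V := TangentSpace (𝓡 m) x) (curvature nabla x) (phi x) (xi x)
      (eta x) where
  toIsCurvatureLike := hnabla.isCurvatureLike x
  contact := h.isAlmostContactMetric x
  apply_xi u v := by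
    obtain ⟨X, hX, rfl, -⟩ := exists_isSmoothField_eventuallyEq_extend u
    obtain ⟨Y, hY, rfl, -⟩ := exists_isSmoothField_eventuallyEq_extend v
    rw [hnabla.curvature_eq hX hY h.xi_smooth, h.curvatureOfFields_xi hnabla hX hY]
  apply_phi u v w := by
    obtain ⟨X, hX, rfl, -⟩ := exists_isSmoothField_eventuallyEq_extend u
    obtain ⟨Y, hY, rfl, -⟩ := exists_isSmoothField_eventuallyEq_extend v
    obtain ⟨Z, hZ, rfl, -⟩ := exists_isSmoothField_eventuallyEq_extend w
    rw [hnabla.curvature_eq hX hY hZ, ← h.curvatureOfFields_phi hnabla hX hY hZ]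
    exact hnabla.curvature_eq hX hY (h.isSmoothField_phi hZ) x

theorem IsSasakianSpaceForm.curvature_apply_phi_self {c : ℝ}
    (h : IsSasakianSpaceForm nabla phi xi eta c) (hnabla : IsLeviCivita nabla) (x : N)
    (u : TangentSpace (𝓡 m) x) (hu : ‖u‖ = 1) :
    curvature nabla x u (phi x u) u = -(c - (c - 1) * eta x u ^ 2) • phi x u := by
  have hφ := h.isAlmostContactMetric x
  refine (h.isSasakianCurvature hnabla x).apply_phi_self (fun v hv hv0 => ?_) u hu
  rw [hφ.eta_eq] at hv0
  have h1 := h.phi_sectional x v hv hv0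
  have h2 : ‖phi x v‖ ^ 2 = 1 := by
    rw [← real_inner_self_eq_norm_sq, hφ.compatible, hφ.eta_eq, hv0, real_inner_self_eq_norm_sq, hv]
    ring
  have h3 : (inner ℝ v (phi x v) : ℝ) = 0 := by rw [real_inner_comm, hφ.inner_map_self]
  rw [sectionalCurvature, h2, h3, hv] at h1
  simpa using h1

end Sasakian

end SasakianCurves

/-! ### Covariant differentiation along a curve. -/

namespace SasakianCurves

section AlongCurve

open Filter Topology

variable {m : ℕ} {N : Type*} [TopologicalSpace N] [ChartedSpace (EuclideanSpace ℝ (Fin m)) N]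
  [IsManifold (𝓡 m) ∞ N]
  {nabla : AffineConnection m N}

theorem isSmoothField_zero : IsSmoothField (0 : Π x : N, TangentSpace (𝓡 m) x) :=
  contMDiff_zeroSection ℝ (fun x : N => TangentSpace (𝓡 m) x)

theorem IsSmoothField.sum_smul {ι : Type*} (s : Finset ι) (a : ι → ℝ)
    {Y : ι → Π x : N, TangentSpace (𝓡 m) x} (hY : ∀ i, IsSmoothField (Y i)) :
    IsSmoothField (∑ i ∈ s, a i • Y i) := by
  classical
  induction s using Finset.induction_on with
  | empty => simpa using isSmoothField_zero
  | insert i s hi ih =>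
    rw [Finset.sum_insert hi]
    exact ((hY i).smul (f := fun _ => a i) contMDiff_const).add ih

theorem nabla_sum_smul {ι : Type*} (s : Finset ι) (a : ι → ℝ)
    {Y : ι → Π x : N, TangentSpace (𝓡 m) x} (hY : ∀ i, IsSmoothField (Y i)) (x : N)
    (u : TangentSpace (𝓡 m) x) :
    nabla (∑ i ∈ s, a i • Y i) x u = ∑ i ∈ s, a i • nabla (Y i) x u := by
  classical
  induction s using Finset.induction_on with
  | empty =>
    rw [Finset.sum_empty, Finset.sum_empty, nabla.zero]
    rfl
  | insert i s hi ih =>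
    have hi' : IsSmoothField (a i • Y i) := (hY i).smul (f := fun _ => a i) contMDiff_const
    rw [Finset.sum_insert hi, Finset.sum_insert hi, nabla_add hi' (IsSmoothField.sum_smul s a hY),
      ← ih,
      nabla.isCovariantDerivativeOnUniv.smul_const _ ((hY i).mdifferentiableAt x)]
    rfl

/-- The components of a vector field along `γ` in the trivialization at `γ t`. -/
noncomputable def alongCoord (γ : ℝ → N) (V : Π t : ℝ, TangentSpace (𝓡 m) (γ t)) (t s : ℝ) :
    EuclideanSpace ℝ (Fin m) :=
  (trivializationAt (EuclideanSpace ℝ (Fin m)) (fun x : N => TangentSpace (𝓡 m) x) (γ t)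
    (⟨γ s, V s⟩ : TangentBundle (𝓡 m) N)).2

/-- The frame consists of the fields with constant components in the trivialization at x, made
global. The same components define `covDerivAlong`, so both of its terms expand in this frame. -/
theorem exists_smooth_frame [T2Space N] (x : N) :
    ∃ Y : Fin m → Π x : N, TangentSpace (𝓡 m) x, (∀ i, IsSmoothField (Y i)) ∧
      ∀ᶠ y in 𝓝 x, ∀ w : EuclideanSpace ℝ (Fin m),
        (trivializationAt (EuclideanSpace ℝ (Fin m)) (fun x : N => TangentSpace (𝓡 m) x) x).symm y w
          = ∑ i, w i • Y i y := by
  set e := trivializationAt (EuclideanSpace ℝ (Fin m)) (fun x : N => TangentSpace (𝓡 m) x) x with he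
  have hx : x ∈ e.baseSet := FiberBundle.mem_baseSet_trivializationAt' x
  have h : ∀ i : Fin m, ∃ X, IsSmoothField X ∧
      (fun y => e.symm y (EuclideanSpace.single i (1 : ℝ))) =ᶠ[𝓝 x] X := by
    intro i
    obtain ⟨X, hX, -, h⟩ := exists_isSmoothField_eventuallyEq_extend
      (e.symm x (EuclideanSpace.single i (1 : ℝ)) : TangentSpace (𝓡 m) x)
    refine ⟨X, hX, ?_⟩
    refine EventuallyEq.trans (EventuallyEq.of_eq (funext fun y => ?_)) h
    change e.symm y _ = e.symm y (e ⟨x, e.symm x (EuclideanSpace.single i (1 : ℝ))⟩).2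
    rw [e.apply_mk_symm hx]
  choose Y hY hY' using h
  refine ⟨Y, hY, ?_⟩
  filter_upwards [e.open_baseSet.mem_nhds hx, eventually_all.mpr hY'] with y hy hy' w
  simp only [← hy']
  rw [← e.symmₗ_apply (R := ℝ) hy]
  simp only [← e.symmₗ_apply (R := ℝ) hy, ← map_smul, ← map_sum]
  congr 1
  ext j
  simp [Finset.sum_apply, Pi.single_apply]

variable [T2Space N] {γ : ℝ → N} {V W : Π t : ℝ, TangentSpace (𝓡 m) (γ t)} {t : ℝ}

/-- There is a smooth local frame near `γ t` in which `∇_T V` is computed componentwise. -/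
theorem exists_frame_along (nabla : AffineConnection m N) (hγ : ContinuousAt γ t) :
    ∃ Y : Fin m → Π x : N, TangentSpace (𝓡 m) x, (∀ i, IsSmoothField (Y i)) ∧
      ∀ V : Π t : ℝ, TangentSpace (𝓡 m) (γ t),
        (∀ᶠ s in 𝓝 t, V s = ∑ i, alongCoord γ V t s i • Y i (γ s)) ∧
        covDerivAlong nabla γ V t = ∑ i, (deriv (alongCoord γ V t) t i • Y i (γ t)
          + alongCoord γ V t t i • nabla (Y i) (γ t) (velocity γ t)) := by
  obtain ⟨Y, hY, h⟩ := exists_smooth_frame (m := m) (γ t)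
  set e := trivializationAt (EuclideanSpace ℝ (Fin m)) (fun x : N => TangentSpace (𝓡 m) x) (γ t)
    with he
  have hx : γ t ∈ e.baseSet := FiberBundle.mem_baseSet_trivializationAt' (γ t)
  refine ⟨Y, hY, fun V => ⟨?_, ?_⟩⟩
  · filter_upwards [hγ.eventually h, hγ.eventually (e.open_baseSet.mem_nhds hx)] with s hs hs'
    rw [← hs, alongCoord, ← he, e.symm_proj_apply ⟨γ s, V s⟩ hs']
  · have h2 : FiberBundle.extend (EuclideanSpace ℝ (Fin m))
        (E := fun x : N => TangentSpace (𝓡 m) x) (V t)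
        =ᶠ[𝓝 (γ t)] ∑ i, alongCoord γ V t t i • Y i := by
      filter_upwards [h] with y hy
      refine (hy _).trans ?_
      exact (Finset.sum_apply y Finset.univ fun i => alongCoord γ V t t i • Y i).symm
    rw [covDerivAlong, nabla_congr (IsSmoothField.sum_smul _ _ hY) h2, nabla_sum_smul _ _ hY,
      Finset.sum_add_distrib, ← he, h.self_of_nhds]
    rfl

/-- Differentiability at `t` of a vector field along `γ`. -/
abbrev MDifferentiableAlongAt (γ : ℝ → N) (V : Π t : ℝ, TangentSpace (𝓡 m) (γ t)) (t : ℝ) : Prop :=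
  MDifferentiableAt 𝓘(ℝ, ℝ) (𝓡 m).tangent (fun s => (⟨γ s, V s⟩ : TangentBundle (𝓡 m) N)) t

omit [T2Space N] in
theorem mdifferentiableAlongAt_iff : MDifferentiableAlongAt γ V t ↔
    MDifferentiableAt 𝓘(ℝ, ℝ) (𝓡 m) γ t ∧ DifferentiableAt ℝ (alongCoord γ V t) t := by
  rw [MDifferentiableAlongAt, mdifferentiableAt_totalSpace, ← mdifferentiableAt_iff_differentiableAt]
  rfl

omit [T2Space N] in
theorem alongCoord_smul (hγ : ContinuousAt γ t) (f : ℝ → ℝ)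
    (V : Π t : ℝ, TangentSpace (𝓡 m) (γ t)) :
    alongCoord γ (fun s => f s • V s) t =ᶠ[𝓝 t] fun s => f s • alongCoord γ V t s := by
  have hx := FiberBundle.mem_baseSet_trivializationAt' (F := EuclideanSpace ℝ (Fin m))
    (E := fun x : N => TangentSpace (𝓡 m) x) (γ t)
  filter_upwards [hγ.eventually ((trivializationAt (EuclideanSpace ℝ (Fin m))
    (fun x : N => TangentSpace (𝓡 m) x) (γ t)).open_baseSet.mem_nhds hx)] with s hs
  exact (Trivialization.linear ℝ _ hs).map_smul (f s) (V s)

omit [T2Space N] in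
theorem alongCoord_add (hγ : ContinuousAt γ t) (V W : Π t : ℝ, TangentSpace (𝓡 m) (γ t)) :
    alongCoord γ (fun s => V s + W s) t
      =ᶠ[𝓝 t] fun s => alongCoord γ V t s + alongCoord γ W t s := by
  have hx := FiberBundle.mem_baseSet_trivializationAt' (F := EuclideanSpace ℝ (Fin m))
    (E := fun x : N => TangentSpace (𝓡 m) x) (γ t)
  filter_upwards [hγ.eventually ((trivializationAt (EuclideanSpace ℝ (Fin m))
    (fun x : N => TangentSpace (𝓡 m) x) (γ t)).open_baseSet.mem_nhds hx)] with s hs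
  exact (Trivialization.linear ℝ _ hs).map_add (V s) (W s)

omit [T2Space N] in
theorem MDifferentiableAlongAt.smul {f : ℝ → ℝ} (hf : DifferentiableAt ℝ f t)
    (hV : MDifferentiableAlongAt γ V t) : MDifferentiableAlongAt γ (fun s => f s • V s) t := by
  rw [mdifferentiableAlongAt_iff] at hV ⊢
  exact ⟨hV.1, (hf.smul hV.2).congr_of_eventuallyEq (alongCoord_smul hV.1.continuousAt f V)⟩

omit [T2Space N] in
theorem MDifferentiableAlongAt.add (hV : MDifferentiableAlongAt γ V t)
    (hW : MDifferentiableAlongAt γ W t) : MDifferentiableAlongAt γ (fun s => V s + W s) t := by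
  rw [mdifferentiableAlongAt_iff] at hV hW ⊢
  exact ⟨hV.1, (hV.2.add hW.2).congr_of_eventuallyEq (alongCoord_add hV.1.continuousAt V W)⟩

omit [T2Space N] in
theorem covDerivAlong_congr (h : ∀ᶠ s in 𝓝 t, V s = W s) :
    covDerivAlong nabla γ V t = covDerivAlong nabla γ W t := by
  rw [covDerivAlong, covDerivAlong, h.self_of_nhds]
  congr 2
  refine EventuallyEq.deriv_eq ?_
  filter_upwards [h] with s hs
  rw [hs]

theorem covDerivAlong_smul {f : ℝ → ℝ} (hf : DifferentiableAt ℝ f t)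
    (hV : MDifferentiableAlongAt γ V t) :
    covDerivAlong nabla γ (fun s => f s • V s) t
      = deriv f t • V t + f t • covDerivAlong nabla γ V t := by
  rw [mdifferentiableAlongAt_iff] at hV
  have hc := hV.1.continuousAt
  obtain ⟨Y, -, h⟩ := exists_frame_along nabla hc
  rw [(h _).2, (h V).2, (alongCoord_smul hc f V).deriv_eq, (alongCoord_smul hc f V).self_of_nhds,
    deriv_fun_smul hf hV.2, (h V).1.self_of_nhds, Finset.smul_sum, Finset.smul_sum,
    ← Finset.sum_add_distrib]
  refine Finset.sum_congr rfl fun i _ => ?_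
  simp only [PiLp.add_apply, PiLp.smul_apply, smul_eq_mul]
  module

theorem covDerivAlong_add (hV : MDifferentiableAlongAt γ V t) (hW : MDifferentiableAlongAt γ W t) :
    covDerivAlong nabla γ (fun s => V s + W s) t
      = covDerivAlong nabla γ V t + covDerivAlong nabla γ W t := by
  rw [mdifferentiableAlongAt_iff] at hV hW
  have hc := hV.1.continuousAt
  obtain ⟨Y, -, h⟩ := exists_frame_along nabla hc
  rw [(h _).2, (h V).2, (h W).2, (alongCoord_add hc V W).deriv_eq,
    (alongCoord_add hc V W).self_of_nhds, deriv_fun_add hV.2 hW.2, ← Finset.sum_add_distrib]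
  refine Finset.sum_congr rfl fun i _ => ?_
  simp only [PiLp.add_apply]
  module

omit [IsManifold (𝓡 m) ∞ N] [T2Space N] in
theorem hasDerivAt_comp_curve {f : N → ℝ} (hf : MDifferentiableAt (𝓡 m) 𝓘(ℝ, ℝ) f (γ t))
    (hγ : MDifferentiableAt 𝓘(ℝ, ℝ) (𝓡 m) γ t) :
    HasDerivAt (fun s => f (γ s)) (mvfderiv (𝓡 m) f (γ t) (velocity γ t)) t := by
  have h1 : MDifferentiableAt 𝓘(ℝ, ℝ) 𝓘(ℝ, ℝ) (f ∘ γ) t := hf.comp t hγ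
  have h2 := (mdifferentiableAt_iff_differentiableAt.mp h1).hasDerivAt
  have h3 := mvfderiv_comp_apply t hf hγ (1 : ℝ)
  have h4 : deriv (f ∘ γ) t = mvfderiv (𝓡 m) f (γ t) (velocity γ t) := by
    rw [velocity, ← h3, mvfderiv, mfderiv_eq_fderiv]
    rfl
  rw [← h4]
  exact h2

/-- Metric compatibility along a curve. -/
theorem IsLeviCivita.hasDerivAt_inner [RiemannianBundle (fun x : N => TangentSpace (𝓡 m) x)]
    [IsContMDiffRiemannianBundle (𝓡 m) ∞ (EuclideanSpace ℝ (Fin m))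
      (fun x : N => TangentSpace (𝓡 m) x)] (hnabla : IsLeviCivita nabla)
    {X : Π x : N, TangentSpace (𝓡 m) x} (hX : IsSmoothField X)
    (hV : MDifferentiableAlongAt γ V t) :
    HasDerivAt (fun s => (inner ℝ (V s) (X (γ s)) : ℝ))
      (inner ℝ (covDerivAlong nabla γ V t) (X (γ t))
        + inner ℝ (V t) (nabla X (γ t) (velocity γ t))) t := by
  rw [mdifferentiableAlongAt_iff] at hV
  have hc := hV.1.continuousAt
  obtain ⟨Y, hY, h⟩ := exists_frame_along nabla hc
  obtain ⟨h1, h2⟩ := h V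
  -- The product rule in the frame: V is a combination of restricted fields, and for these metric
  -- compatibility on N and the chain rule apply.
  have h3 : ∀ i, HasDerivAt (fun s => alongCoord γ V t s i * (inner ℝ (Y i (γ s)) (X (γ s)) : ℝ))
      (deriv (alongCoord γ V t) t i * inner ℝ (Y i (γ t)) (X (γ t)) + alongCoord γ V t t i
        * (inner ℝ (nabla (Y i) (γ t) (velocity γ t)) (X (γ t))
          + inner ℝ (Y i (γ t)) (nabla X (γ t) (velocity γ t)))) t := by
    intro i
    have h4 := hasDerivAt_comp_curve (((hY i).inner hX).mdifferentiable (by simp) (γ t)) hV.1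
    rw [hnabla.mvfderiv_inner (hY i) hX] at h4
    have h5 : HasDerivAt (fun s => alongCoord γ V t s i) (deriv (alongCoord γ V t) t i) t :=
      (EuclideanSpace.proj (𝕜 := ℝ) i).hasFDerivAt.comp_hasDerivAt t hV.2.hasDerivAt
    exact h5.mul h4
  have h6 := HasDerivAt.fun_sum (u := Finset.univ) fun i _ => h3 i
  refine HasDerivAt.congr_of_eventuallyEq (h6.congr_deriv ?_) ?_
  · rw [h2, h1.self_of_nhds]
    simp only [sum_inner, inner_add_left, real_inner_smul_left]
    rw [← Finset.sum_add_distrib]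
    refine Finset.sum_congr rfl fun i _ => ?_
    ring
  · filter_upwards [h1] with s hs
    rw [hs]
    simp only [sum_inner, real_inner_smul_left]

end AlongCurve

end SasakianCurves

/-! ### Tension and bitension in a Frenet frame. -/

namespace SasakianCurves

section Frenet

open Filter Topology

variable {m : ℕ} {N : Type*} [TopologicalSpace N] [ChartedSpace (EuclideanSpace ℝ (Fin m)) N]
  [IsManifold (𝓡 m) ∞ N] [RiemannianBundle (fun x : N => TangentSpace (𝓡 m) x)]
  {nabla : AffineConnection m N} {J : Set ℝ} {γ : ℝ → N} {r : ℕ}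
  {E : ℕ → Π t : ℝ, TangentSpace (𝓡 m) (γ t)} {κ : ℕ → ℝ → ℝ} {t : ℝ}

/-- The part `κ₂ E₃` of `∇_T E₂` that is orthogonal to `E₁`, in a Frenet frame of order `r`. -/
noncomputable def frenetNormal (E : ℕ → Π t : ℝ, TangentSpace (𝓡 m) (γ t)) (κ : ℕ → ℝ → ℝ) (r : ℕ)
    (t : ℝ) : TangentSpace (𝓡 m) (γ t) :=
  if 2 < r then κ 2 t • E 3 t else 0

omit [IsManifold (𝓡 m) ∞ N] [RiemannianBundle (fun x : N => TangentSpace (𝓡 m) x)] in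
theorem frenetNormal_of_lt (h : 2 < r) : frenetNormal E κ r = fun t => κ 2 t • E 3 t := by
  ext1 t
  rw [frenetNormal, if_pos h]

namespace IsFrenetFrame

variable (hF : IsFrenetFrame nabla γ J r E κ) (hJ : IsOpen J) (ht : t ∈ J)
include hF ht

theorem norm_velocity : ‖(velocity γ t : TangentSpace (𝓡 m) (γ t))‖ = 1 := by
  have h := hF.orthonormal 1 (by simp [hF.one_le]) 1 (by simp [hF.one_le]) t ht
  rw [hF.first t ht, if_pos rfl, real_inner_self_eq_norm_sq] at h
  nlinarith [norm_nonneg (velocity γ t : TangentSpace (𝓡 m) (γ t))]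

theorem inner_eq {i j : ℕ} (hi : 1 ≤ i) (hir : i ≤ r) (hj : 1 ≤ j) (hjr : j ≤ r) :
    (inner ℝ (E i t) (E j t) : ℝ) = if i = j then 1 else 0 :=
  hF.orthonormal i (by simp [hi, hir]) j (by simp [hj, hjr]) t ht

theorem pos {i : ℕ} (hi : 1 ≤ i) (hir : i < r) : 0 < κ i t :=
  hF.curvature_pos i (by simp [hi, hir]) t ht

theorem covDerivAlong_two (hr : 2 ≤ r) :
    covDerivAlong nabla γ (E 2) t = -(κ 1 t • E 1 t) + frenetNormal E κ r t := by
  rw [hF.frenet 2 (by simp; omega) t ht, if_pos (by omega), frenetNormal]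

include hJ

theorem mdifferentiableAlongAt {i : ℕ} (hi : 1 ≤ i) (hir : i ≤ r) :
    MDifferentiableAlongAt γ (E i) t :=
  ((hF.frame_smooth i (by simp [hi, hir])).contMDiffAt (hJ.mem_nhds ht)).mdifferentiableAt
    (by simp)

theorem differentiableAt_curvature {i : ℕ} (hi : 1 ≤ i) (hir : i < r) :
    DifferentiableAt ℝ (κ i) t :=
  ((hF.curvature_smooth i (by simp [hi, hir])).contDiffAt (hJ.mem_nhds ht)).differentiableAt
    (by simp)

theorem differentiableAt_deriv_curvature {i : ℕ} (hi : 1 ≤ i) (hir : i < r) :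
    DifferentiableAt ℝ (deriv (κ i)) t :=
  (((hF.curvature_smooth i (by simp [hi, hir])).deriv_of_isOpen (m := 1) hJ
    (by rw [one_add_one_eq_two]; exact ENat.LEInfty.out)).contDiffAt (hJ.mem_nhds ht)).differentiableAt (by simp)

theorem tension_eq_covDerivAlong : tension nabla γ t = covDerivAlong nabla γ (E 1) t := by
  refine covDerivAlong_congr ?_
  filter_upwards [hJ.mem_nhds ht] with s hs
  exact (hF.first s hs).symm

theorem tension_eq_zero (hr : r = 1) : tension nabla γ t = 0 := by
  rw [hF.tension_eq_covDerivAlong hJ ht, hF.frenet 1 (by simp [hr]) t ht]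
  simp [hr]

theorem tension_eq (hr : 2 ≤ r) : tension nabla γ t = κ 1 t • E 2 t := by
  rw [hF.tension_eq_covDerivAlong hJ ht, hF.frenet 1 (by simp; omega) t ht, if_neg (by omega),
    if_pos (by omega), zero_add]

variable [T2Space N]

omit [T2Space N] in
theorem mdifferentiableAlongAt_frenetNormal :
    MDifferentiableAlongAt γ (frenetNormal E κ r) t := by
  by_cases h : 2 < r
  · rw [frenetNormal_of_lt h]
    exact (hF.mdifferentiableAlongAt hJ ht (by omega) (by omega)).smul
      (hF.differentiableAt_curvature hJ ht (by omega) h)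
  -- The zero field is treated as `0 • E 1`, whose differentiability is known.
  · have := (hF.mdifferentiableAlongAt hJ ht le_rfl hF.one_le).smul (f := fun _ => (0 : ℝ))
      (differentiableAt_const _)
    convert this using 3 with s
    simp [frenetNormal, h]

theorem covDerivAlong_frenetNormal_two (hr : r = 2) :
    covDerivAlong nabla γ (frenetNormal E κ r) t = 0 := by
  have h : frenetNormal E κ r = fun t => (0 : ℝ) • E 1 t := by
    ext1 t
    rw [frenetNormal, if_neg (by omega), zero_smul]
  rw [h, covDerivAlong_smul (differentiableAt_const _)
    (hF.mdifferentiableAlongAt hJ ht le_rfl hF.one_le)]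
  simp

theorem covDerivAlong_frenetNormal (hr : 2 < r) :
    covDerivAlong nabla γ (frenetNormal E κ r) t
      = deriv (κ 2) t • E 3 t - κ 2 t ^ 2 • E 2 t
        + if 3 < r then (κ 2 t * κ 3 t) • E 4 t else 0 := by
  rw [frenetNormal_of_lt hr, covDerivAlong_smul (hF.differentiableAt_curvature hJ ht (by omega) hr)
    (hF.mdifferentiableAlongAt hJ ht (by omega) (by omega)), hF.frenet 3 (by simp; omega) t ht,
    if_pos (by omega)]
  split_ifs
  · module
  · module

theorem covDerivAlong_tension (hr : 2 ≤ r) :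
    covDerivAlong nabla γ (tension nabla γ) t
      = deriv (κ 1) t • E 2 t + (-(κ 1 t ^ 2) • E 1 t + κ 1 t • frenetNormal E κ r t) := by
  have h : covDerivAlong nabla γ (tension nabla γ) t
      = covDerivAlong nabla γ (fun s => κ 1 s • E 2 s) t := by
    refine covDerivAlong_congr ?_
    filter_upwards [hJ.mem_nhds ht] with s hs
    exact hF.tension_eq hJ hs hr
  rw [h, covDerivAlong_smul (hF.differentiableAt_curvature hJ ht le_rfl (by omega))
    (hF.mdifferentiableAlongAt hJ ht (by omega) hr), hF.covDerivAlong_two ht hr]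
  module

theorem covDerivAlong_covDerivAlong_tension (hr : 2 ≤ r) :
    covDerivAlong nabla γ (covDerivAlong nabla γ (tension nabla γ)) t
      = -(3 * κ 1 t * deriv (κ 1) t) • E 1 t + (deriv (deriv (κ 1)) t - κ 1 t ^ 3) • E 2 t
        + (2 * deriv (κ 1) t) • frenetNormal E κ r t
        + κ 1 t • covDerivAlong nabla γ (frenetNormal E κ r) t := by
  have d1 := hF.differentiableAt_curvature hJ ht (le_refl 1) (by omega)
  have d2 := hF.differentiableAt_deriv_curvature hJ ht (le_refl 1) (by omega)
  have d3 : HasDerivAt (fun s => -(κ 1 s ^ 2)) (-(2 * κ 1 t * deriv (κ 1) t)) t := by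
    have := (d1.hasDerivAt.fun_pow 2).fun_neg
    simpa using this
  have e1 := hF.mdifferentiableAlongAt hJ ht (le_refl 1) (by omega)
  have e2 := hF.mdifferentiableAlongAt hJ ht (show 1 ≤ 2 by omega) hr
  have e3 := hF.mdifferentiableAlongAt_frenetNormal hJ ht
  have h : covDerivAlong nabla γ (covDerivAlong nabla γ (tension nabla γ)) t
      = covDerivAlong nabla γ (fun s => deriv (κ 1) s • E 2 s
        + (-(κ 1 s ^ 2) • E 1 s + κ 1 s • frenetNormal E κ r s)) t := by
    refine covDerivAlong_congr ?_
    filter_upwards [hJ.mem_nhds ht] with s hs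
    exact hF.covDerivAlong_tension hJ hs hr
  have f1 : MDifferentiableAlongAt γ (fun s => -(κ 1 s ^ 2) • E 1 s) t :=
    MDifferentiableAlongAt.smul d3.differentiableAt e1
  rw [h, covDerivAlong_add (e2.smul d2) (f1.add (e3.smul d1)), covDerivAlong_add f1 (e3.smul d1),
    covDerivAlong_smul d2 e2, covDerivAlong_smul d3.differentiableAt e1, covDerivAlong_smul d1 e3,
    hF.covDerivAlong_two ht hr, d3.deriv, ← hF.tension_eq_covDerivAlong hJ ht,
    hF.tension_eq hJ ht hr]
  module

end IsFrenetFrame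

variable [IsContMDiffRiemannianBundle (𝓡 m) ∞ (EuclideanSpace ℝ (Fin m))
      (fun x : N => TangentSpace (𝓡 m) x)]
  [CovariantDerivative.ContMDiffCovariantDerivative nabla ∞] [T2Space N]
  {phi : Π x : N, TangentSpace (𝓡 m) x →L[ℝ] TangentSpace (𝓡 m) x}
  {xi : Π x : N, TangentSpace (𝓡 m) x}
  {eta : Π x : N, TangentSpace (𝓡 m) x →L[ℝ] ℝ} {c : ℝ}

omit [IsManifold (𝓡 m) ∞ N] [IsContMDiffRiemannianBundle (𝓡 m) ∞ (EuclideanSpace ℝ (Fin m))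
      (fun x : N => TangentSpace (𝓡 m) x)] [T2Space N]
  [CovariantDerivative.ContMDiffCovariantDerivative nabla ∞] in
theorem AreParallel.exists_smul_eq {V : Type*} [AddCommGroup V] [Module ℝ V] {u v : V}
    (h : AreParallel u v) (hv : v ≠ 0) : ∃ a : ℝ, u = a • v := by
  obtain ⟨a, b, hab, h⟩ := h
  have ha : a ≠ 0 := by
    rintro rfl
    rw [zero_smul] at h
    exact (hab.resolve_left (by simp)) ((smul_eq_zero.mp h.symm).resolve_right hv)
  exact ⟨a⁻¹ * b, by rw [mul_smul, ← h, smul_smul, inv_mul_cancel₀ ha, one_smul]⟩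

omit [IsManifold (𝓡 m) ∞ N] [IsContMDiffRiemannianBundle (𝓡 m) ∞ (EuclideanSpace ℝ (Fin m))
      (fun x : N => TangentSpace (𝓡 m) x)] [T2Space N]
  [CovariantDerivative.ContMDiffCovariantDerivative nabla ∞] in
theorem IsContactMetric.inner_phi_self [IsManifold (𝓡 m) ∞ N] (h : IsContactMetric phi xi eta)
    (x : N) {u : TangentSpace (𝓡 m) x} (hu : ‖u‖ = 1) :
    (inner ℝ (phi x u) (phi x u) : ℝ) = 1 - eta x u ^ 2 := by
  rw [h.compatible, real_inner_self_eq_norm_sq, hu]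
  ring

namespace IsFrenetFrame

variable (hF : IsFrenetFrame nabla γ J r E κ) (hJ : IsOpen J)
  (h : IsSasakianSpaceForm nabla phi xi eta c) (hnabla : IsLeviCivita nabla)
  (hpar : ∀ t ∈ J, AreParallel (covDerivAlong nabla γ (velocity γ) t)
      (phi (γ t) (velocity γ t)))
include hF hJ h hnabla hpar

/-- Since φT ≠ 0, κ₁E₂ = a φT for some a. Hence R(T, κ₁E₂)T is a R(T, φT)T, again a multiple of E₂,
and a need not be computed. -/
theorem bitension_eq (hr : 2 ≤ r) (ht : t ∈ J) (hη : eta (γ t) (velocity γ t) ^ 2 ≠ 1) :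
    bitension nabla γ t
      = -(3 * κ 1 t * deriv (κ 1) t) • E 1 t
        + (deriv (deriv (κ 1)) t - κ 1 t ^ 3
          + (c - (c - 1) * eta (γ t) (velocity γ t) ^ 2) * κ 1 t) • E 2 t
        + (2 * deriv (κ 1) t) • frenetNormal E κ r t
        + κ 1 t • covDerivAlong nabla γ (frenetNormal E κ r) t := by
  have hu := hF.norm_velocity ht
  have hphi : phi (γ t) (velocity γ t) ≠ 0 := by
    intro h0
    have := h.inner_phi_self (γ t) hu
    rw [h0, inner_zero_left] at this
    exact hη (by linarith)
  obtain ⟨a, ha⟩ := (hpar t ht).exists_smul_eq hphi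
  have h1 : κ 1 t • E 2 t = a • phi (γ t) (velocity γ t) := by
    rw [← ha, ← hF.tension_eq hJ ht hr]
    rfl
  have h2 : curvature nabla (γ t) (velocity γ t) (tension nabla γ t) (velocity γ t)
      = -((c - (c - 1) * eta (γ t) (velocity γ t) ^ 2) * κ 1 t) • E 2 t := by
    rw [neg_smul, mul_smul, h1, hF.tension_eq hJ ht hr, h1,
      (hnabla.isCurvatureLike (γ t)).smul_two, h.curvature_apply_phi_self hnabla (γ t) _ hu]
    module
  rw [bitension, h2, hF.covDerivAlong_covDerivAlong_tension hJ ht hr]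
  module

-- As g(T, ∇_T ξ) = -g(T, φT) = 0, the derivative is η(∇_T T). Where φT ≠ 0 it vanishes because η ∘
-- φ = 0. Where φT = 0 parallelism says nothing, but there η(T) = ±1 is an extremum of a function
-- bounded by 1 in absolute value.
omit [CovariantDerivative.ContMDiffCovariantDerivative nabla ∞] in
theorem hasDerivAt_eta_velocity (ht : t ∈ J) :
    HasDerivAt (fun s => eta (γ s) (velocity γ s)) 0 t := by
  have hφ := h.isAlmostContactMetric
  have hu := hF.norm_velocity ht
  have hle : ∀ s ∈ J, eta (γ s) (velocity γ s) ^ 2 ≤ 1 := by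
    intro s hs
    have := h.inner_phi_self (γ s) (hF.norm_velocity hs)
    linarith [real_inner_self_nonneg (x := phi (γ s) (velocity γ s))]
  have hT : MDifferentiableAlongAt (m := m) γ (velocity γ) t := by
    refine MDifferentiableAt.congr_of_eventuallyEq
      (hF.mdifferentiableAlongAt hJ ht le_rfl hF.one_le) ?_
    filter_upwards [hJ.mem_nhds ht] with s hs
    rw [hF.first s hs]
  have hd := hnabla.hasDerivAt_inner h.xi_smooth hT
  simp only [← (hφ _).eta_eq] at hd
  rw [h.nabla_xi hnabla, inner_neg_right, real_inner_comm, (hφ _).inner_map_self, neg_zero,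
    add_zero] at hd
  convert hd using 1
  by_cases hphi : phi (γ t) (velocity γ t) = 0
  · have h1 := h.inner_phi_self (γ t) hu
    rw [hphi, inner_zero_left] at h1
    have h2 : (eta (γ t) (velocity γ t) - 1) * (eta (γ t) (velocity γ t) + 1) = 0 := by linarith
    rw [← hd.deriv]
    rcases mul_eq_zero.mp h2 with h3 | h3
    · refine (IsLocalMax.deriv_eq_zero ?_).symm
      filter_upwards [hJ.mem_nhds ht] with s hs
      nlinarith [hle s hs]
    · refine (IsLocalMin.deriv_eq_zero ?_).symm
      filter_upwards [hJ.mem_nhds ht] with s hs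
      nlinarith [hle s hs]
  · obtain ⟨a, ha⟩ := (hpar t ht).exists_smul_eq hphi
    rw [ha, map_smul, (hφ _).eta_map, smul_zero]

end IsFrenetFrame

end Frenet

end SasakianCurves

/-! ### The biharmonic equation for the Frenet curvatures, and the angle. -/

namespace SasakianCurves

section Biharmonic

open Filter Topology

variable {m : ℕ} {N : Type*} [TopologicalSpace N] [ChartedSpace (EuclideanSpace ℝ (Fin m)) N]
  [IsManifold (𝓡 m) ∞ N] [RiemannianBundle (fun x : N => TangentSpace (𝓡 m) x)]
  [IsContMDiffRiemannianBundle (𝓡 m) ∞ (EuclideanSpace ℝ (Fin m))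
      (fun x : N => TangentSpace (𝓡 m) x)] [T2Space N]
  {nabla : AffineConnection m N} {J : Set ℝ} {γ : ℝ → N} {r : ℕ}
  {E : ℕ → Π t : ℝ, TangentSpace (𝓡 m) (γ t)} {κ : ℕ → ℝ → ℝ} {t : ℝ}
  {phi : Π x : N, TangentSpace (𝓡 m) x →L[ℝ] TangentSpace (𝓡 m) x}
  {xi : Π x : N, TangentSpace (𝓡 m) x}
  {eta : Π x : N, TangentSpace (𝓡 m) x →L[ℝ] ℝ} {c : ℝ}

namespace IsFrenetFrame

variable (hF : IsFrenetFrame nabla γ J r E κ) (hJ : IsOpen J)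
include hF hJ

omit [IsContMDiffRiemannianBundle (𝓡 m) ∞ (EuclideanSpace ℝ (Fin m))
  (fun x : N => TangentSpace (𝓡 m) x)] [T2Space N] in
theorem tension_ne_zero (ht : t ∈ J) (hr : 2 ≤ r) : tension nabla γ t ≠ 0 := by
  intro h0
  rw [hF.tension_eq hJ ht hr] at h0
  have h1 := congrArg (fun v => (inner ℝ v (E 2 t) : ℝ)) h0
  simp only [real_inner_smul_left, inner_zero_left, hF.inner_eq ht (show 1 ≤ 2 by omega) hr
    (show 1 ≤ 2 by omega) hr, if_true] at h1
  linarith [hF.pos ht (i := 1) le_rfl (by omega)]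

omit [IsContMDiffRiemannianBundle (𝓡 m) ∞ (EuclideanSpace ℝ (Fin m))
  (fun x : N => TangentSpace (𝓡 m) x)] [T2Space N] in
theorem not_isHarmonicOn (ht : t ∈ J) (hr : 2 ≤ r) : ¬ IsHarmonicOn nabla γ J :=
  fun h => hF.tension_ne_zero hJ ht hr (h t ht)

omit [IsContMDiffRiemannianBundle (𝓡 m) ∞ (EuclideanSpace ℝ (Fin m))
  (fun x : N => TangentSpace (𝓡 m) x)] [T2Space N] in
theorem two_le_of_not_isHarmonicOn (h : ¬ IsHarmonicOn nabla γ J) : 2 ≤ r := by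
  by_contra hr
  exact h fun t ht => hF.tension_eq_zero hJ ht (by have := hF.one_le; omega)

/-- A curve with `η(T) = ± 1` is a geodesic. -/
theorem eta_velocity_sq_ne_one (h : IsSasakian nabla phi xi eta) (hnabla : IsLeviCivita nabla)
    (hr : 2 ≤ r) (ht : t ∈ J)
    {f : ℝ} (hf : ∀ s ∈ J, eta (γ s) (velocity γ s) = f) : f ^ 2 ≠ 1 := by
  intro hf1
  have hφ := h.isAlmostContactMetric
  have hT : ∀ s ∈ J, velocity γ s = f • xi (γ s) := by
    intro s hs
    have h1 : (inner ℝ (velocity γ s - f • xi (γ s)) (velocity γ s - f • xi (γ s)) : ℝ) = 0 := by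
      have h2 : (inner ℝ (velocity γ s) (velocity γ s : TangentSpace (𝓡 m) (γ s)) : ℝ) = 1 := by
        rw [real_inner_self_eq_norm_sq, hF.norm_velocity hs, one_pow]
      simp only [inner_sub_left, inner_sub_right, real_inner_smul_left, real_inner_smul_right,
        (hφ _).inner_xi_xi, real_inner_comm (velocity γ s) (xi (γ s)), ← (hφ _).eta_eq (velocity γ s),
        hf s hs, h2]
      linarith
    exact sub_eq_zero.mp (inner_self_eq_zero.mp h1)
  have hd : MDifferentiableAlongAt (m := m) γ (velocity γ) t := by
    refine MDifferentiableAt.congr_of_eventuallyEq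
      (hF.mdifferentiableAlongAt hJ ht le_rfl hF.one_le) ?_
    filter_upwards [hJ.mem_nhds ht] with s hs
    rw [hF.first s hs]
  have hxi0 : nabla xi (γ t) (velocity γ t) = 0 := by
    rw [h.nabla_xi hnabla, hT t ht, (hφ _).map_smul, (hφ _).map_xi, smul_zero, neg_zero]
  refine hF.tension_ne_zero hJ ht hr (tangent_ext fun w => ?_)
  obtain ⟨X, hX, rfl, -⟩ := exists_isSmoothField_eventuallyEq_extend w
  -- Near t the functions g(T, X) and f g(ξ, X) agree. Comparing their derivatives, with ∇_T ξ = 0,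
  -- shows that ∇_T T is orthogonal to the arbitrary vector X(γ t).
  have h1 := hnabla.hasDerivAt_inner hX hd
  have hxi : IsSmoothField xi := h.xi_smooth
  have h2 := (hasDerivAt_comp_curve ((hxi.inner hX).mdifferentiable (by simp) (γ t))
    (mdifferentiableAlongAt_iff.mp hd).1).const_mul f
  rw [hnabla.mvfderiv_inner hxi hX, hxi0, inner_zero_left, zero_add] at h2
  have h3 : (fun s => f * (inner ℝ (xi (γ s)) (X (γ s)) : ℝ))
      =ᶠ[𝓝 t] fun s => (inner ℝ (velocity γ s) (X (γ s)) : ℝ) := by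
    filter_upwards [hJ.mem_nhds ht] with s hs
    rw [hT s hs, real_inner_smul_left]
  have h4 := h1.unique (h2.congr_of_eventuallyEq h3.symm)
  rw [hT t ht, real_inner_smul_left] at h4
  rw [inner_zero_left, tension]
  rw [hT t ht] at *
  linarith

variable [CovariantDerivative.ContMDiffCovariantDerivative nabla ∞]
  (h : IsSasakianSpaceForm nabla phi xi eta c) (hnabla : IsLeviCivita nabla)
  (hpar : ∀ t ∈ J, AreParallel (covDerivAlong nabla γ (velocity γ) t)
      (phi (γ t) (velocity γ t)))
include h hnabla hpar

/-- The equations for the curvatures of a biharmonic curve. -/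
theorem curvature_equations (hr : 2 ≤ r) (ht : t ∈ J) (hη : eta (γ t) (velocity γ t) ^ 2 ≠ 1)
    (hb : bitension nabla γ t = 0) :
    deriv (κ 1) t = 0 ∧ r ≤ 3 ∧ (r = 3 → deriv (κ 2) t = 0) ∧
      deriv (deriv (κ 1)) t - κ 1 t * (κ 1 t ^ 2 + (if 2 < r then κ 2 t ^ 2 else 0)
        - (c - (c - 1) * eta (γ t) (velocity γ t) ^ 2)) = 0 := by
  have hk1 := hF.pos ht (i := 1) le_rfl (by omega)
  have e : ∀ {i j : ℕ}, 1 ≤ i → i ≤ r → 1 ≤ j → j ≤ r →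
      (inner ℝ (E i t) (E j t) : ℝ) = if i = j then 1 else 0 := fun hi hi' hj hj' =>
    hF.inner_eq ht hi hi' hj hj'
  rw [hF.bitension_eq hJ h hnabla hpar hr ht hη] at hb
  have e11 := e (le_refl 1) (by omega) (le_refl 1) (by omega)
  have e21 := e (show 1 ≤ 2 by omega) hr (le_refl 1) (by omega)
  have e22 := e (show 1 ≤ 2 by omega) hr (show 1 ≤ 2 by omega) hr
  have e12 := e (le_refl 1) (by omega) (show 1 ≤ 2 by omega) hr
  by_cases hr2 : r = 2
  · rw [hF.covDerivAlong_frenetNormal_two hJ ht hr2, frenetNormal, if_neg (by omega)] at hb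
    have i1 := congrArg (fun v => (inner ℝ v (E 1 t) : ℝ)) hb
    have i2 := congrArg (fun v => (inner ℝ v (E 2 t) : ℝ)) hb
    simp only [inner_add_left, real_inner_smul_left, inner_zero_left, smul_zero, e11, e21, e22, e12]
      at i1 i2
    norm_num at i1 i2
    refine ⟨i1.resolve_left hk1.ne', by omega, by omega, ?_⟩
    rw [if_neg (by omega)]
    linarith
  have hr3 : 2 < r := by omega
  have hk2 := hF.pos ht (i := 2) (by omega) hr3
  have e31 := e (show 1 ≤ 3 by omega) hr3 (le_refl 1) (by omega)
  have e32 := e (show 1 ≤ 3 by omega) hr3 (show 1 ≤ 2 by omega) hr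
  have e33 := e (show 1 ≤ 3 by omega) hr3 (show 1 ≤ 3 by omega) hr3
  have e13 := e (le_refl 1) (by omega) (show 1 ≤ 3 by omega) hr3
  have e23 := e (show 1 ≤ 2 by omega) hr (show 1 ≤ 3 by omega) hr3
  rw [hF.covDerivAlong_frenetNormal hJ ht hr3, frenetNormal, if_pos hr3] at hb
  -- In order 4 or more the E₄-component is κ₁κ₂κ₃, which is positive.
  by_cases hr4 : 3 < r
  · exfalso
    have hk3 := hF.pos ht (i := 3) (by omega) hr4
    have e14 := e (le_refl 1) (by omega) (show 1 ≤ 4 by omega) hr4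
    have e24 := e (show 1 ≤ 2 by omega) hr (show 1 ≤ 4 by omega) hr4
    have e34 := e (show 1 ≤ 3 by omega) hr3 (show 1 ≤ 4 by omega) hr4
    have e44 := e (show 1 ≤ 4 by omega) hr4 (show 1 ≤ 4 by omega) hr4
    have i4 := congrArg (fun v => (inner ℝ v (E 4 t) : ℝ)) hb
    simp only [if_pos hr4, inner_add_left, inner_sub_left, real_inner_smul_left, inner_zero_left,
      e14, e24, e34, e44] at i4
    norm_num at i4
    rcases i4 with i4 | i4 | i4
    · exact hk1.ne' i4
    · exact hk2.ne' i4
    · exact hk3.ne' i4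
  · rw [if_neg hr4] at hb
    have i1 := congrArg (fun v => (inner ℝ v (E 1 t) : ℝ)) hb
    have i2 := congrArg (fun v => (inner ℝ v (E 2 t) : ℝ)) hb
    have i3 := congrArg (fun v => (inner ℝ v (E 3 t) : ℝ)) hb
    simp only [inner_add_left, inner_sub_left, real_inner_smul_left, inner_zero_left, e11, e21,
      e22, e12, e31, e32, e33, e13, e23] at i1 i2 i3
    norm_num at i1 i2 i3
    have d1 : deriv (κ 1) t = 0 := i1.resolve_left hk1.ne'
    refine ⟨d1, by omega, fun _ => ?_, ?_⟩
    · rw [d1] at i3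
      simpa [hk1.ne'] using i3
    · rw [if_pos hr3]
      linarith

/-- A curve of order `2` or `3` with constant curvatures whose squares add up to
`c - (c - 1) η(T)²` is biharmonic. -/
theorem bitension_eq_zero (hr : 2 ≤ r) (hr3 : r ≤ 3) {k₁ k₂ : ℝ} (hk₁ : ∀ s ∈ J, κ 1 s = k₁)
    (hk₂ : 2 < r → ∀ s ∈ J, κ 2 s = k₂) (ht : t ∈ J) (hη : eta (γ t) (velocity γ t) ^ 2 ≠ 1)
    (hk : k₁ ^ 2 + (if 2 < r then k₂ ^ 2 else 0) = c - (c - 1) * eta (γ t) (velocity γ t) ^ 2) :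
    bitension nabla γ t = 0 := by
  have hd : ∀ {f : ℝ → ℝ} {k : ℝ}, (∀ s ∈ J, f s = k) → ∀ s ∈ J, deriv f s = 0 := by
    intro f k hf s hs
    have : f =ᶠ[𝓝 s] fun _ => k := by
      filter_upwards [hJ.mem_nhds hs] with y hy using hf y hy
    rw [this.deriv_eq, deriv_const]
  have d1 := hd hk₁
  rw [hF.bitension_eq hJ h hnabla hpar hr ht hη, d1 t ht, hd d1 t ht, ← hk, hk₁ t ht]
  by_cases hr2 : 2 < r
  · rw [hF.covDerivAlong_frenetNormal hJ ht hr2, hd (hk₂ hr2) t ht, hk₂ hr2 t ht,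
      if_pos hr2, if_neg (show ¬ 3 < r by omega)]
    module
  · rw [hF.covDerivAlong_frenetNormal_two hJ ht (by omega), frenetNormal, if_neg hr2, if_neg hr2]
    module

end IsFrenetFrame

theorem isConst_of_hasDerivAt_zero (hJ : IsOpen J) (hJ' : J.OrdConnected) {f : ℝ → ℝ}
    (hf : ∀ s ∈ J, HasDerivAt f 0 s) {t : ℝ} (ht : t ∈ J) : ∀ s ∈ J, f s = f t := fun _ hs =>
  hJ.is_const_of_deriv_eq_zero hJ'.isPreconnected
    (fun y hy => (hf y hy).differentiableAt.differentiableWithinAt) (fun y hy => (hf y hy).deriv)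
    hs ht

/-- The angle is arccos f, which lies in (0, π) because |f| < 1; the value π/2 is excluded by f ≠ 0,
that is, by the curve not being Legendre. -/
theorem exists_angle {f : ℝ} (hf : f ^ 2 < 1) (hf0 : f ≠ 0) :
    ∃ β ∈ Ioo 0 (2 * Real.pi) \ {Real.pi / 2, Real.pi, 3 * Real.pi / 2}, Real.cos β = f := by
  have h1 : -1 < f := by nlinarith
  have h2 : f < 1 := by nlinarith
  have hpi := Real.pi_pos
  have hc := Real.cos_arccos h1.le h2.le
  have h3 : Real.arccos f < Real.pi := by
    refine lt_of_le_of_ne (Real.arccos_le_pi f) fun h => ?_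
    rw [h, Real.cos_pi] at hc
    linarith
  refine ⟨Real.arccos f, ⟨⟨Real.arccos_pos.mpr h2, by linarith⟩, ?_⟩, hc⟩
  rintro (h | h | h)
  · rw [h, Real.cos_pi_div_two] at hc
    exact hf0 hc.symm
  · linarith
  · rw [h] at h3
    linarith

theorem cos_sq_ne_one_of_mem {β : ℝ} (hβ : β ∈ Ioo 0 (2 * Real.pi)) (hβ' : β ≠ Real.pi) :
    Real.cos β ^ 2 ≠ 1 := by
  intro h
  have hs : Real.sin β = 0 := by
    have := Real.sin_sq_add_cos_sq β
    nlinarith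
  obtain ⟨n, hn⟩ := Real.sin_eq_zero_iff.mp hs
  have hpi := Real.pi_pos
  have h1 : (0 : ℝ) < n := by
    by_contra hc
    have := hβ.1
    nlinarith
  have h2 : (n : ℝ) < 2 := by
    by_contra hc
    have := hβ.2
    nlinarith
  have h3 : n = 1 := by
    have : 0 < n := by exact_mod_cast h1
    have : n < 2 := by exact_mod_cast h2
    omega
  rw [h3] at hn
  exact hβ' (by simpa using hn.symm)

end Biharmonic

end SasakianCurves

/-! ### The characterisation of proper-biharmonic curves. -/

open SasakianCurves in
theorem propositionp1 (n : ℕ) {N : Type*} [TopologicalSpace N] [T2Space N]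
    [ChartedSpace (EuclideanSpace ℝ (Fin (2 * n + 1))) N]
    [IsManifold (𝓡 (2 * n + 1)) ∞ N]
    [RiemannianBundle (fun x : N => TangentSpace (𝓡 (2 * n + 1)) x)]
    [IsContMDiffRiemannianBundle (𝓡 (2 * n + 1)) ∞ (EuclideanSpace ℝ (Fin (2 * n + 1)))
      (fun x : N => TangentSpace (𝓡 (2 * n + 1)) x)]
    -- the (smooth) Levi-Civita connection
    (nabla : AffineConnection (2 * n + 1) N)
    [CovariantDerivative.ContMDiffCovariantDerivative nabla ∞]
    (hnabla : IsLeviCivita nabla)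
    -- the Sasakian space form of constant `φ`-sectional curvature `c ≠ 1`
    (phi : Π x : N, TangentSpace (𝓡 (2 * n + 1)) x →L[ℝ] TangentSpace (𝓡 (2 * n + 1)) x)
    (xi : Π x : N, TangentSpace (𝓡 (2 * n + 1)) x)
    (eta : Π x : N, TangentSpace (𝓡 (2 * n + 1)) x →L[ℝ] ℝ)
    (c : ℝ) (hN : IsSasakianSpaceForm nabla phi xi eta c) (hc : c ≠ 1)
    -- the non-Legendre Frenet curve on the open interval `J`
    (J : Set ℝ) (hJ : IsOpen J) (hJ' : J.OrdConnected)
    (γ : ℝ → N) (r : ℕ) (hγ : IsFrenetCurve nabla γ J r)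
    (hnonLegendre : ∃ t ∈ J, eta (γ t) (velocity γ t) ≠ 0)
    -- `∇_T T ∥ φ T`
    (hpar : ∀ t ∈ J, AreParallel (covDerivAlong nabla γ (velocity γ) t)
      (phi (γ t) (velocity γ t))) :
    IsProperBiharmonicOn nabla γ J ↔
      ∃ β₀ ∈ Ioo 0 (2 * Real.pi) \ {Real.pi / 2, Real.pi, 3 * Real.pi / 2},
        0 < c - (c - 1) * Real.cos β₀ ^ 2 ∧
        ((∃ κ₁, IsCircle nabla γ J κ₁ ∧ (∀ t ∈ J, eta (γ t) (velocity γ t) = Real.cos β₀) ∧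
            κ₁ ^ 2 = c - (c - 1) * Real.cos β₀ ^ 2) ∨
          (∃ κ₁ κ₂, IsHelix nabla γ J κ₁ κ₂ ∧
            (∀ t ∈ J, eta (γ t) (velocity γ t) = Real.cos β₀) ∧
            κ₁ ^ 2 + κ₂ ^ 2 = c - (c - 1) * Real.cos β₀ ^ 2)) := by
  obtain ⟨t₀, ht₀, hη₀⟩ := hnonLegendre
  constructor
  · rintro ⟨hb, hh⟩
    obtain ⟨E, κ, hF⟩ := hγ
    have hr := hF.two_le_of_not_isHarmonicOn hJ hh
    have hη := isConst_of_hasDerivAt_zero hJ hJ'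
      (fun t ht => hF.hasDerivAt_eta_velocity hJ hN hnabla hpar ht) ht₀
    generalize eta (γ t₀) (velocity γ t₀) = f at hη hη₀
    have hf1 := hF.eta_velocity_sq_ne_one hJ hN.toIsSasakian hnabla hr ht₀ hη
    have hf : f ^ 2 < 1 := by
      refine lt_of_le_of_ne ?_ hf1
      have h1 := hN.inner_phi_self (γ t₀) (hF.norm_velocity ht₀)
      rw [hη t₀ ht₀] at h1
      linarith [real_inner_self_nonneg (x := phi (γ t₀) (velocity γ t₀))]
    have key := fun t (ht : t ∈ J) => hF.curvature_equations hJ hN hnabla hpar hr ht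
      (by rwa [hη t ht]) (hb t ht)
    have hκ₁ := isConst_of_hasDerivAt_zero hJ hJ' (fun t ht => (key t ht).1 ▸
      (hF.differentiableAt_curvature hJ ht le_rfl (by omega)).hasDerivAt) ht₀
    have hk := (key t₀ ht₀).2.2.2
    have hpos := hF.pos ht₀ (i := 1) le_rfl (by omega)
    -- The equation at a single point keeps κ₁''; it drops out because κ₁' vanishes on a whole
    -- neighbourhood.
    have hdd : deriv (deriv (κ 1)) t₀ = 0 := by
      have : deriv (κ 1) =ᶠ[nhds t₀] fun _ => 0 := by
        filter_upwards [hJ.mem_nhds ht₀] with t ht using (key t ht).1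
      rw [this.deriv_eq, deriv_const]
    rw [hdd, zero_sub, neg_eq_zero, mul_eq_zero, hη t₀ ht₀] at hk
    have hk' := sub_eq_zero.mp (hk.resolve_left hpos.ne')
    obtain ⟨β, hβ, hcos⟩ := exists_angle hf hη₀
    refine ⟨β, hβ, ?_, ?_⟩
    -- The bound on c holds because the expression equals κ₁² (+ κ₂²) with κ₁ > 0.
    · rw [hcos, ← hk']
      split_ifs <;> positivity
    · rw [hcos]
      by_cases hr2 : r = 2
      · subst hr2
        rw [if_neg (by omega), add_zero] at hk'
        exact Or.inl ⟨κ 1 t₀, ⟨E, κ, hF, hκ₁⟩, hη, hk'⟩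
      · obtain rfl : r = 3 := by
          have := (key t₀ ht₀).2.1
          omega
        rw [if_pos (by omega)] at hk'
        have hκ₂ := isConst_of_hasDerivAt_zero hJ hJ' (fun t ht => (key t ht).2.2.1 rfl ▸
          (hF.differentiableAt_curvature hJ ht (i := 2) (by omega) (by omega)).hasDerivAt) ht₀
        exact Or.inr ⟨κ 1 t₀, κ 2 t₀, ⟨E, κ, hF, fun t ht => ⟨hκ₁ t ht, hκ₂ t ht⟩⟩, hη, hk'⟩
  · rintro ⟨β, ⟨hβ, hβ'⟩, -, hcase⟩
    -- Excluding β = π ensures φT ≠ 0, which `bitension_eq_zero` requires.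
    have hcos := cos_sq_ne_one_of_mem hβ (fun h => hβ' (by simp [h]))
    rcases hcase with ⟨k₁, ⟨E, κ, hF, hκ⟩, hη, hk⟩ | ⟨k₁, k₂, ⟨E, κ, hF, hκ⟩, hη, hk⟩
    · refine ⟨fun t ht => ?_, hF.not_isHarmonicOn hJ ht₀ le_rfl⟩
      exact hF.bitension_eq_zero hJ hN hnabla hpar le_rfl (by omega) hκ (k₂ := 0)
        (fun h => absurd h (lt_irrefl 2)) ht (by rwa [hη t ht]) (by simp [hη t ht, hk])
    · refine ⟨fun t ht => ?_, hF.not_isHarmonicOn hJ ht₀ (by omega)⟩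
      exact hF.bitension_eq_zero hJ hN hnabla hpar (by omega) le_rfl (fun t ht => (hκ t ht).1)
        (fun _ t ht => (hκ t ht).2) ht (by rwa [hη t ht]) (by simp [hη t ht, hk])
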